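/- Let $0=b_0<b_1<\dots<b_N$ with $N\ge 1$, let $a_1,\dots,a_N$ be nonzero reals, and let $V=-\sum_{n=1}^N a_n^2\chi_{[-b_n,-b_{n-1})}$. For a compactly supported potential and $k\in\mathbb C$, the right and left reflection coefficients $R(k)$, $L(k)$ are defined by solutions of $-\phi''+V\phi=k^2\phi$ with $\phi_r=e^{-ikx}+R(k)e^{ikx}$ near $+\infty$, $\phi_r=T(k)e^{-ikx}$ near $-\infty$, and $\phi_l=e^{ikx}+L(k)e^{-ikx}$ near $-\infty$, $\phi_l=T(k)e^{ikx}$ near $+\infty$. The number $-\kappa^2$ ($\kappa>0$) is a bound state if $-\phi''+V\phi=-\kappa^2\phi$ has a nonzero solution in $L^2(\mathbb R)$, and the left norming constant is then $c=\|\phi_l(\cdot,i\kappa)T(i\kappa)^{-1}\|_{2}^{-1}$, where $\phi_l/T$ is the solution that equals $e^{ikx}$ near $+\infty$. Write $\tilde f(k)=f(-k)$. Let $R_n^0$ be the right reflection coefficient of $-a_n^2\chi_{[-(b_n-b_{n-1}),0)}$, let $R_{1,\dots,n},L_{1,\dots,n}$ be the reflection coefficients of $-\sum_{j\le n} a_j^2\chi_{[-b_j,-b_{j-1})}$,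 and put $$A_n=\frac{L_{1,\dots,n}}{R_{1,\dots,n}}e^{2ikb_n},\qquad B_n=L_{1,\dots,n}e^{2ikb_n},\qquad M_n=\begin{pmatrix}-R_n^0&-\tilde R_{n+1}^0\tilde R_n^0\\ R_{n+1}^0R_n^0&\tilde R_n^0\end{pmatrix},$$ $$\begin{pmatrix}p_1\\q_1\end{pmatrix}=\begin{pmatrix}-\tilde R_1\\1\end{pmatrix},\qquad \begin{pmatrix}p_{n+1}\\q_{n+1}\end{pmatrix}=M_n\begin{pmatrix}p_n\\q_n\end{pmatrix}\quad(1\le n<N).$$ Then the following hold. (1) For $1\le n\le N$ the functions $R_n^0,R_{1,\dots,n},L_{1,\dots,n},A_n,B_n,p_n,q_n$ are meromorphic in $\mathbb C$, and, as meromorphic functions, $B_n=-\dfrac{R_n^0}{\tilde R_n^0}\dfrac{p_n}{q_n}$. (2) As meromorphic functions, $R_{1}=R_1^0$, $A_1=1$, and for $1\le n<N$ $$R_{1,\dots,n+1}=-\frac{R_{1,\dots,n}}{\tilde R_{1,\dots,n}}\,\frac{A_nR_{n+1}^0-\tilde R_{1,\dots,n}}{1-A_nR_{n+1}^0R_{1,\dots,n}},\qquad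 A_{n+1}=\frac{R_{n+1}^0}{\tilde R_{n+1}^0}\,\frac{\tilde R_{1,\dots,n}}{R_{1,\dots,n}}\,\frac{A_nR_{1,\dots,n}-\tilde R_{n+1}^0}{A_nR_{n+1}^0-\tilde R_{1,\dots,n}},$$ $$\begin{pmatrix}p_{n+1}'\\q_{n+1}'\end{pmatrix}=M_n\begin{pmatrix}p_n'\\q_n'\end{pmatrix}+M_n'\begin{pmatrix}p_n\\q_n\end{pmatrix}.$$ (3) If $-\kappa^2$, $\kappa>0$, is a bound state of $V$ with left norming constant $c$, then $c>0$, $i\kappa$ is a simple pole of $B_N$, $A_N$ has a finite nonzero value at $i\kappa$, and $\operatorname{Res}_{k=i\kappa}B_N=ic^2A_N(i\kappa)$. (4) Let $\kappa>0$ and suppose that $q_N(i\kappa)=0$, that $\det(M_{N-1}\cdots M_1)$ does not vanish at $i\kappa$, and that $i\kappa$ is not a pole of $\tilde R_N^0$. Then $i\kappa$ is a simple pole of $B_N$ and of $R_{1,\dots,N}$, $-\kappa^2$ is a bound state of $V$, the values of $R_N^0/\tilde R_N^0$, $p_N$, $q_N'$ and $A_N$ at $i\kappa$ are finite and nonzero,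 and $$\operatorname{Res}_{k=i\kappa}B_N=-\frac{R_N^0}{\tilde R_N^0}(i\kappa)\,\frac{p_N(i\kappa)}{q_N'(i\kappa)}=i\,c^2A_N(i\kappa),\qquad\text{so that}\qquad c^2=\frac{i\,p_N(i\kappa)}{q_N'(i\kappa)\,A_N(i\kappa)}\cdot\frac{R_N^0}{\tilde R_N^0}(i\kappa),$$ where $c$ is the left norming constant at $i\kappa$. Values of meromorphic functions at a point are understood after removal of removable singularities. -/

import Mathlib

open Filter Topology MeasureTheory

namespace BlockScattering

noncomputable section

/-! ### The Schrödinger equation, scattering coefficients, bound states, norming constants -/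

/-- `φ` solves `-φ'' + V φ = lam φ` on the line: `φ` is differentiable, and its derivative `ψ`
is an indefinite integral of `(V - lam) φ`. (For piecewise constant `V` this says that `φ` is
`C¹` and that the equation holds away from the jumps of `V`.) -/
def IsSolution (V : ℝ → ℝ) (lam : ℂ) (φ : ℝ → ℂ) : Prop :=
  ∃ ψ : ℝ → ℂ, (∀ x, HasDerivAt φ (ψ x) x) ∧
    ∀ x y, ψ y - ψ x = ∫ t in x..y, ((V t : ℂ) - lam) * φ t

/-- `ρ` is the coefficient of the reflected wave in a right Jost solution at `k`: a solution for
the energy `k ^ 2` that is `e^{-ikx} + ρ e^{ikx}` near `+∞` and `τ e^{-ikx}` near `-∞`.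
The potentials considered here have compact support, so that a solution is exactly a combination
of the two exponentials outside a bounded interval and no error term appears; this
gives the coefficient also for nonreal `k`. -/
def IsRightReflection (V : ℝ → ℝ) (k ρ : ℂ) : Prop :=
  ∃ (φ : ℝ → ℂ) (τ : ℂ), IsSolution V (k ^ 2) φ ∧
    (∀ᶠ x : ℝ in atTop,
      φ x = Complex.exp (-(Complex.I * k * x)) + ρ * Complex.exp (Complex.I * k * x)) ∧
    (∀ᶠ x : ℝ in atBot, φ x = τ * Complex.exp (-(Complex.I * k * x)))

/-- `ρ` is the coefficient of the reflected wave in a left Jost solution at `k`: a solution for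
the energy `k ^ 2` that is `e^{ikx} + ρ e^{-ikx}` near `-∞` and `τ e^{ikx}` near `+∞`. -/
def IsLeftReflection (V : ℝ → ℝ) (k ρ : ℂ) : Prop :=
  ∃ (φ : ℝ → ℂ) (τ : ℂ), IsSolution V (k ^ 2) φ ∧
    (∀ᶠ x : ℝ in atBot,
      φ x = Complex.exp (Complex.I * k * x) + ρ * Complex.exp (-(Complex.I * k * x))) ∧
    (∀ᶠ x : ℝ in atTop, φ x = τ * Complex.exp (Complex.I * k * x))

open Classical in
/-- The right reflection coefficient `R(k)` of a compactly supported potential, on the complex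
plane (with the value `0` where no right Jost solution exists, which happens at its poles). -/
def rightReflection (V : ℝ → ℝ) (k : ℂ) : ℂ :=
  if h : ∃ ρ, IsRightReflection V k ρ then h.choose else 0

open Classical in
/-- The left reflection coefficient `L(k)` of a compactly supported potential, on the complex
plane (with the value `0` where no left Jost solution exists, which happens at its poles). -/
def leftReflection (V : ℝ → ℝ) (k : ℂ) : ℂ :=
  if h : ∃ ρ, IsLeftReflection V k ρ then h.choose else 0

open Classical in
/-- The function `φ_l(·, k) / T(k)`, where `φ_l` is the left Jost solution and `T` the transmission
coefficient: the solution for the energy `k ^ 2` that is equal to `e^{ikx}` near `+∞`. -/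
def leftJostOverT (V : ℝ → ℝ) (k : ℂ) : ℝ → ℂ :=
  if h : ∃ f : ℝ → ℂ, IsSolution V (k ^ 2) f ∧
      ∀ᶠ x : ℝ in atTop, f x = Complex.exp (Complex.I * k * x) then h.choose else 0

/-- The left norming constant `‖φ_l(·, iκ) / T(iκ)‖₂⁻¹`. -/
def leftNormingConstant (V : ℝ → ℝ) (κ : ℝ) : ℝ :=
  (Real.sqrt (∫ x : ℝ, ‖leftJostOverT V (Complex.I * κ) x‖ ^ 2))⁻¹

/-- `lam` is a bound state: a negative energy with a nonzero square-integrable solution. -/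
def IsBoundState (V : ℝ → ℝ) (lam : ℝ) : Prop :=
  lam < 0 ∧ ∃ φ : ℝ → ℂ, IsSolution V (lam : ℂ) φ ∧ φ ≠ 0 ∧ MemLp φ 2 volume

/-! ### Values and residues of meromorphic functions -/

/-- The meromorphic function `f` takes the finite value `w` at `z`. The value is the limit at `z`,
so that removable singularities play no role and no value is given to a pole. -/
def HasValueAt (f : ℂ → ℂ) (z w : ℂ) : Prop :=
  Tendsto f (𝓝[≠] z) (𝓝 w)

/-- `z` is a pole of `f`. -/
def IsPole (f : ℂ → ℂ) (z : ℂ) : Prop :=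
  meromorphicOrderAt f z < 0

/-- `z` is a simple pole of `f`. -/
def IsSimplePole (f : ℂ → ℂ) (z : ℂ) : Prop :=
  meromorphicOrderAt f z = -1

/-- The residue of `f` at the isolated singularity `z` is `c`: `∮ f = 2πi c` over all
sufficiently small circles about `z`. -/
def HasResidueAt (f : ℂ → ℂ) (z c : ℂ) : Prop :=
  ∀ᶠ r : ℝ in 𝓝[>] 0, (∮ w in C(z, r), f w) = 2 * Real.pi * Complex.I * c

/-- `f̃(k) = f(-k)`. -/
def tilde (f : ℂ → ℂ) (k : ℂ) : ℂ := f (-k)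

/-! ### Potentials made of blocks

The data are the depths `a 1, a 2, …` and the endpoints `0 = b 0 < b 1 < b 2 < …`. -/

/-- The potential of a single well of width `h` shifted to the origin: `-a²` on `[-h, 0)`. -/
def well (a h : ℝ) : ℝ → ℝ :=
  (Set.Ico (-h) 0).indicator fun _ => -a ^ 2

/-- The potential of the first `n` blocks: `-(a j)²` on `[-b j, -b (j - 1))` for `1 ≤ j ≤ n`. -/
def blocks (a b : ℕ → ℝ) (n : ℕ) (x : ℝ) : ℝ :=
  ∑ j ∈ Finset.Icc 1 n, (Set.Ico (-b j) (-b (j - 1))).indicator (fun _ => -(a j) ^ 2) x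

/-- `R_n^0`: the right reflection coefficient of the `n`-th block shifted to the origin. -/
def R0 (a b : ℕ → ℝ) (n : ℕ) : ℂ → ℂ :=
  rightReflection (well (a n) (b n - b (n - 1)))

/-- `R_{1,…,n}`: the right reflection coefficient of the first `n` blocks. -/
def R (a b : ℕ → ℝ) (n : ℕ) : ℂ → ℂ := rightReflection (blocks a b n)

/-- `L_{1,…,n}`: the left reflection coefficient of the first `n` blocks. -/
def L (a b : ℕ → ℝ) (n : ℕ) : ℂ → ℂ := leftReflection (blocks a b n)

/-- `A_n = (L_{1,…,n} / R_{1,…,n}) e^{2 i k b_n}`. -/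
def A (a b : ℕ → ℝ) (n : ℕ) (k : ℂ) : ℂ :=
  L a b n k / R a b n k * Complex.exp (2 * Complex.I * k * b n)

/-- `B_n = L_{1,…,n} e^{2 i k b_n}` (which is `A_n R_{1,…,n}`). -/
def B (a b : ℕ → ℝ) (n : ℕ) (k : ℂ) : ℂ :=
  L a b n k * Complex.exp (2 * Complex.I * k * b n)

/-- The matrix `M_n` of the linear recursion. -/
def M (a b : ℕ → ℝ) (n : ℕ) (k : ℂ) : Matrix (Fin 2) (Fin 2) ℂ :=
  !![-R0 a b n k, -(tilde (R0 a b (n + 1)) k * tilde (R0 a b n) k);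
     R0 a b (n + 1) k * R0 a b n k, tilde (R0 a b n) k]

/-- The product `M_n ⋯ M_2 M_1`. -/
def prodM (a b : ℕ → ℝ) : ℕ → ℂ → Matrix (Fin 2) (Fin 2) ℂ
  | 0, _ => 1
  | n + 1, k => M a b (n + 1) k * prodM a b n k

/-- The vectors `(p_n, q_n)`, `n ≥ 1`: `(p_1, q_1) = (-R̃_1, 1)` and
`(p_{n+1}, q_{n+1}) = M_n (p_n, q_n)`. (The index `0` is not used.) -/
def pq (a b : ℕ → ℝ) : ℕ → ℂ → Fin 2 → ℂ
  | 0, _ => 0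
  | 1, k => ![-tilde (R a b 1) k, 1]
  | n + 2, k => (M a b (n + 1) k).mulVec (pq a b (n + 1) k)

/-- The function `p_n`. -/
def p (a b : ℕ → ℝ) (n : ℕ) (k : ℂ) : ℂ := pq a b n k 0

/-- The function `q_n`. -/
def q (a b : ℕ → ℝ) (n : ℕ) (k : ℂ) : ℂ := pq a b n k 1

/-- The entrywise derivative `M_n'`. -/
def derivM (a b : ℕ → ℝ) (n : ℕ) (k : ℂ) : Matrix (Fin 2) (Fin 2) ℂ :=
  Matrix.of fun i j => deriv (fun z => M a b n z i j) k

end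

end BlockScattering

open BlockScattering

/-! All scattering data are quotients of entire functions coming from one solution. Let $F_k$ be the
solution for the first $n$ blocks that equals $e^{ikx}$ on $[0,\infty)$. To the left of $-b_n$ one
has $2ikF_k=D_n(k)e^{ik(x+b_n)}+G_n(k)e^{-ik(x+b_n)}$ with entire $D_n,G_n$ (`jostD`, `jostG`;
entire because $\cos(\sqrt z\,t)$ and $\sin(\sqrt z\,t)/\sqrt z$ are entire in $z=k^2+a^2$).
Matching exponentials gives $R=\tilde G_n/D_n$, $B_n=G_n/D_n$, $A_n=G_n/\tilde G_n$
(`isRightReflection_iff`, `isLeftReflection_iff`), and constancy of the Wronskian gives $D_n\tilde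
D_n-G_n\tilde G_n=4k^2$.

For a single well write $d_n,e_n$ (`nthD`, `nthE`); $e_n$ is even, so $R_n^0=e_n/d_n$ and $\tilde
R_n^0=e_n/\tilde d_n$. Adding a block acts linearly on $(D_n,G_n)$. The matrices $M_n$ are this
action up to scalars, which yields $p_n=-d_nG_n\mu$, $q_n=\tilde d_nD_n\mu$ with a common factor
$\mu$ (`p_q_eq`); the formula for $B_n$ and the recursions for $R$ and $A$ are then algebra. These
identities hold off a discrete set: at $k=i\kappa$ with $\kappa$ large the Jost solution has a
definite sign pattern, so none of the entire functions vanishes identically (`eventually_generic`).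

Bound states are the zeros $i\kappa$ of $D_N$. The Wronskian identity for two energies computes
$D_N'(i\kappa)$ through $\|F_{i\kappa}\|_2^2=c^{-2}$. With $G_N\tilde G_N=-4k^2$ at the zero it
becomes $\tilde G_N=ic^2D_N'$ (`leftNormingConstant_pos_and`). Hence the zero is simple and the
residue $G_N/D_N'$ of $B_N$ is $ic^2A_N$.

For a zero of $q_N=\tilde d_ND_N\mu$, the determinant of the recursion is $\mu^2d_1\tilde
d_1d_N\tilde d_N$. The two exclusions in the hypotheses force $\tilde d_N$, $\mu$ and $d_N$ to be
finite and nonzero, so the zero comes from $D_N$ (`factors_at_zero`). -/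

namespace BlockScattering

noncomputable section

/-! ### The free propagator -/

section

open scoped Matrix.Norms.Operator

/-- The fundamental matrix of `y' = w`, `w' = -z y`. -/
def propagator (z : ℂ) (t : ℝ) : Matrix (Fin 2) (Fin 2) ℂ :=
  NormedSpace.exp (t • (!![0, 1; -z, 0] : Matrix (Fin 2) (Fin 2) ℂ))

/-- The solution of `y'' = -z y`, `y(0) = 1`, `y'(0) = 0`; it is `cos (√z t)`. -/
def waveCos (z : ℂ) (t : ℝ) : ℂ := propagator z t 0 0

/-- The solution of `y'' = -z y`, `y(0) = 0`, `y'(0) = 1`; it is `sin (√z t) / √z`. -/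
def waveSin (z : ℂ) (t : ℝ) : ℂ := propagator z t 0 1

/-- A matrix entry as a continuous linear functional. -/
def entryCLM (i j : Fin 2) : Matrix (Fin 2) (Fin 2) ℂ →L[ℂ] ℂ :=
  LinearMap.toContinuousLinearMap (Matrix.entryLinearMap ℂ ℂ i j)

lemma hasDerivAt_propagator (z : ℂ) (t : ℝ) (i j : Fin 2) :
    HasDerivAt (fun t => propagator z t i j)
      ((propagator z t * !![0, 1; -z, 0]) i j) t := by
  have h := hasDerivAt_exp_smul_const (𝕂 := ℝ) (!![0, 1; -z, 0] : Matrix (Fin 2) (Fin 2) ℂ) t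
  exact ((entryCLM i j).restrictScalars ℝ).hasFDerivAt.comp_hasDerivAt t h

lemma waveCos_hasDerivAt (z : ℂ) (t : ℝ) :
    HasDerivAt (waveCos z) (-z * waveSin z t) t := by
  have := hasDerivAt_propagator z t 0 0
  simpa [Matrix.mul_apply, Fin.sum_univ_two, mul_comm] using! this

lemma waveSin_hasDerivAt (z : ℂ) (t : ℝ) :
    HasDerivAt (waveSin z) (waveCos z t) t := by
  have := hasDerivAt_propagator z t 0 1
  simpa [Matrix.mul_apply, Fin.sum_univ_two] using! this

@[simp] lemma waveCos_zero (z : ℂ) : waveCos z 0 = 1 := by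
  simp [waveCos, propagator]

@[simp] lemma waveSin_zero (z : ℂ) : waveSin z 0 = 0 := by
  simp [waveSin, propagator]

/-- Solutions of `y'' = -z y` are determined by the initial values. -/
lemma eq_wave_of_hasDerivAt {z : ℂ} {y w : ℝ → ℂ} (hy : ∀ t, HasDerivAt y (w t) t)
    (hw : ∀ t, HasDerivAt w (-z * y t) t) (t : ℝ) :
    y t = waveCos z t * y 0 + waveSin z t * w 0 := by
  -- The inverse of the fundamental matrix applied to `(y, w)` has derivative zero.
  have key : ∀ {y w : ℝ → ℂ}, (∀ t, HasDerivAt y (w t) t) → (∀ t, HasDerivAt w (-z * y t) t) →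
      ∀ t, waveCos z t * y t - waveSin z t * w t = y 0 ∧
        z * waveSin z t * y t + waveCos z t * w t = w 0 := by
    intro y w hy hw t
    constructor
    · have h : ∀ t, HasDerivAt (fun t => waveCos z t * y t - waveSin z t * w t) 0 t := by
        intro t
        refine (((waveCos_hasDerivAt z t).fun_mul (hy t)).fun_sub
          ((waveSin_hasDerivAt z t).fun_mul (hw t))).congr_deriv ?_
        ring
      simpa using is_const_of_deriv_eq_zero (fun t => (h t).differentiableAt)
        (fun t => (h t).deriv) t 0
    · have h : ∀ t, HasDerivAt (fun t => z * waveSin z t * y t + waveCos z t * w t) 0 t := by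
        intro t
        refine ((((waveSin_hasDerivAt z t).const_mul z).fun_mul (hy t)).fun_add
          ((waveCos_hasDerivAt z t).fun_mul (hw t))).congr_deriv ?_
        ring
      simpa using is_const_of_deriv_eq_zero (fun t => (h t).differentiableAt)
        (fun t => (h t).deriv) t 0
  -- The conservation law for `waveCos` itself says that the fundamental matrix has determinant 1,
  -- which is what inverting `h1` and `h2` requires.
  have hs := (key (waveCos_hasDerivAt z) (fun t => (waveSin_hasDerivAt z t).const_mul (-z)) t).1
  have h1 := (key hy hw t).1
  have h2 := (key hy hw t).2
  simp only [waveCos_zero] at hs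
  linear_combination (waveCos z t) * h1 + waveSin z t * h2 - (y t) * hs

lemma waveCos_sq_add (z : ℂ) (t : ℝ) : waveCos z t ^ 2 + z * waveSin z t ^ 2 = 1 := by
  have h : ∀ t, HasDerivAt (fun t => waveCos z t ^ 2 + z * waveSin z t ^ 2) 0 t := by
    intro t
    refine (((waveCos_hasDerivAt z t).fun_pow 2).fun_add
      (((waveSin_hasDerivAt z t).fun_pow 2).const_mul z)).congr_deriv ?_
    push_cast; ring
  simpa using is_const_of_deriv_eq_zero (fun t => (h t).differentiableAt)
    (fun t => (h t).deriv) t 0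

/-- Joint continuity is needed so that integrals of the Jost solution over a bounded interval are
continuous in `k`. -/
lemma continuous_propagator : Continuous fun x : ℂ × ℝ => propagator x.1 x.2 := by
  have h0 : Continuous fun x : ℂ × ℝ =>
      x.2 • (!![0, 1; -x.1, 0] : Matrix (Fin 2) (Fin 2) ℂ) := by
    refine continuous_snd.smul ?_
    refine continuous_matrix fun i j => ?_
    fin_cases i <;> fin_cases j <;> simp <;> fun_prop
  exact NormedSpace.exp_continuous.comp h0

lemma continuous_waveCos : Continuous fun x : ℂ × ℝ => waveCos x.1 x.2 :=
  (entryCLM 0 0).continuous.comp continuous_propagator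

lemma continuous_waveSin : Continuous fun x : ℂ × ℝ => waveSin x.1 x.2 :=
  (entryCLM 0 1).continuous.comp continuous_propagator

lemma differentiable_propagator (t : ℝ) : Differentiable ℂ fun z => propagator z t := by
  have h0 : (fun z : ℂ => t • (!![0, 1; -z, 0] : Matrix (Fin 2) (Fin 2) ℂ)) =
      fun z => t • (!![0, 1; 0, 0] : Matrix (Fin 2) (Fin 2) ℂ) +
        z • (t • (!![0, 0; -1, 0] : Matrix (Fin 2) (Fin 2) ℂ)) := by
    funext z; ext i j
    fin_cases i <;> fin_cases j <;> simp [mul_comm]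
  have h1 : Differentiable ℂ fun z : ℂ => t • (!![0, 1; -z, 0] : Matrix (Fin 2) (Fin 2) ℂ) := by
    rw [h0]
    fun_prop
  intro z
  exact (NormedSpace.exp_analytic (𝕂 := ℂ) _).differentiableAt.comp z (h1 z)

lemma differentiable_waveCos (t : ℝ) : Differentiable ℂ fun z => waveCos z t :=
  (entryCLM 0 0).differentiable.comp (differentiable_propagator t)

lemma differentiable_waveSin (t : ℝ) : Differentiable ℂ fun z => waveSin z t :=
  (entryCLM 0 1).differentiable.comp (differentiable_propagator t)

/-- The fundamental system for a negative parameter. -/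
lemma wave_neg_sq {η : ℝ} (hη : η ≠ 0) (t : ℝ) :
    waveCos (-(η : ℂ) ^ 2) t = (Real.cosh (η * t) : ℝ) ∧
      waveSin (-(η : ℂ) ^ 2) t = (Real.sinh (η * t) / η : ℝ) := by
  have hη' : (η : ℂ) ≠ 0 := by exact_mod_cast hη
  have hc : ∀ t : ℝ, HasDerivAt (fun t : ℝ => ((Real.cosh (η * t) : ℝ) : ℂ))
      ((η * Real.sinh (η * t) : ℝ) : ℂ) t := by
    intro t
    refine HasDerivAt.ofReal_comp ?_
    refine ((Real.hasDerivAt_cosh (η * t)).comp t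
      ((hasDerivAt_id t).const_mul η)).congr_deriv ?_
    ring
  have hs : ∀ t : ℝ, HasDerivAt (fun t : ℝ => ((Real.sinh (η * t) / η : ℝ) : ℂ))
      ((Real.cosh (η * t) : ℝ) : ℂ) t := by
    intro t
    refine HasDerivAt.ofReal_comp ?_
    refine (((Real.hasDerivAt_sinh (η * t)).comp t
      ((hasDerivAt_id t).const_mul η)).div_const η).congr_deriv ?_
    field_simp
  constructor
  · have hw : (fun t : ℝ => ((η * Real.sinh (η * t) : ℝ) : ℂ)) =
        fun t : ℝ => (η : ℂ) ^ 2 * ((Real.sinh (η * t) / η : ℝ) : ℂ) := by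
      funext t; push_cast; field_simp
    have h := eq_wave_of_hasDerivAt (z := -(η : ℂ) ^ 2) hc
      (fun t => by
        rw [hw]
        exact ((hs t).const_mul ((η : ℂ) ^ 2)).congr_deriv (by ring)) t
    simpa using h.symm
  · have h := eq_wave_of_hasDerivAt (z := -(η : ℂ) ^ 2) hs
      (fun t => by
        refine (hc t).congr_deriv ?_
        push_cast; field_simp) t
    simpa using h.symm

/-- The fundamental system in terms of exponentials. -/
lemma wave_sq (k : ℂ) (t : ℝ) :
    waveCos (k ^ 2) t + Complex.I * k * waveSin (k ^ 2) t = Complex.exp (Complex.I * k * t) := by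
  have hd : ∀ t : ℝ, HasDerivAt (fun t : ℝ => Complex.exp (Complex.I * k * t))
      (Complex.I * k * Complex.exp (Complex.I * k * t)) t := by
    intro t
    have h1 : HasDerivAt (fun t : ℝ => Complex.I * k * (t : ℂ)) (Complex.I * k) t := by
      simpa using (Complex.ofRealCLM.hasDerivAt (x := t)).const_mul (Complex.I * k)
    exact h1.cexp.congr_deriv (by ring)
  have h := eq_wave_of_hasDerivAt (z := k ^ 2) hd
    (fun t => by
      refine ((hd t).const_mul (Complex.I * k)).congr_deriv ?_
      linear_combination (k ^ 2 * Complex.exp (Complex.I * k * t)) * Complex.I_sq) t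
  simp only [Complex.ofReal_zero, mul_zero, Complex.exp_zero, mul_one] at h
  rw [h]; ring

end

lemma waveCos_neg_right (z : ℂ) (t : ℝ) : waveCos z (-t) = waveCos z t := by
  have hd : ∀ t : ℝ, HasDerivAt (fun t => waveCos z (-t)) (z * waveSin z (-t)) t := fun t =>
    ((waveCos_hasDerivAt z (-t)).scomp t (hasDerivAt_neg t)).congr_deriv (by simp)
  have h := eq_wave_of_hasDerivAt (z := z) hd (fun t =>
    (((waveSin_hasDerivAt z (-t)).scomp t (hasDerivAt_neg t)).const_mul z).congr_deriv
      (by simp)) t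
  simpa using h

lemma waveSin_neg_right (z : ℂ) (t : ℝ) : waveSin z (-t) = -waveSin z t := by
  have hd : ∀ t : ℝ, HasDerivAt (fun t => waveSin z (-t)) (-waveCos z (-t)) t := fun t =>
    ((waveSin_hasDerivAt z (-t)).scomp t (hasDerivAt_neg t)).congr_deriv (by simp)
  have h := eq_wave_of_hasDerivAt (z := z) hd (fun t =>
    ((waveCos_hasDerivAt z (-t)).scomp t (hasDerivAt_neg t)).fun_neg.congr_deriv (by simp)) t
  simpa using h

/-! ### Pointwise solutions away from the jumps, and Wronskians -/

/-- `φ` solves `-φ'' + V φ = lam φ` with derivative `ψ`, pointwise away from `S`. -/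
structure SolvesOff (S : Set ℝ) (V : ℝ → ℝ) (lam : ℂ) (φ ψ : ℝ → ℂ) : Prop where
  hasDerivAt : ∀ x, HasDerivAt φ (ψ x) x
  continuous_deriv : Continuous ψ
  hasDerivAt_deriv : ∀ x, x ∉ S → HasDerivAt ψ (((V x : ℂ) - lam) * φ x) x

namespace SolvesOff

variable {S : Set ℝ} {V : ℝ → ℝ} {lam : ℂ} {φ ψ : ℝ → ℂ}

lemma continuous (h : SolvesOff S V lam φ ψ) : Continuous φ :=
  continuous_iff_continuousAt.2 fun x => (h.hasDerivAt x).continuousAt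

lemma intervalIntegrable_mul (hV : ∀ x y, IntervalIntegrable V volume x y)
    (hφ : Continuous φ) (lam : ℂ) (x y : ℝ) :
    IntervalIntegrable (fun t => ((V t : ℂ) - lam) * φ t) volume x y := by
  have h : IntervalIntegrable (fun t => (V t : ℂ)) volume x y :=
    ⟨(hV x y).1.ofReal, (hV x y).2.ofReal⟩
  exact (h.sub intervalIntegrable_const).mul_continuousOn hφ.continuousOn

/-- A countable exceptional set is harmless because `ψ` is continuous: the fundamental theorem of
calculus still applies. -/
lemma isSolution (h : SolvesOff S V lam φ ψ) (hS : S.Countable)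
    (hV : ∀ x y, IntervalIntegrable V volume x y) : IsSolution V lam φ := by
  refine ⟨ψ, h.hasDerivAt, fun x y => ?_⟩
  exact (integral_eq_of_hasDerivAt_off_countable ψ _ hS h.continuous_deriv.continuousOn
    (fun t ht => h.hasDerivAt_deriv t ht.2) (intervalIntegrable_mul hV h.continuous lam x y)).symm

lemma of_isSolution (hφ : IsSolution V lam φ) (hVm : Measurable V)
    (hV : ∀ x y, IntervalIntegrable V volume x y) (hVc : ∀ x, x ∉ S → ContinuousAt V x) :
    ∃ ψ, SolvesOff S V lam φ ψ := by
  obtain ⟨ψ, h1, h2⟩ := hφ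
  have hc : Continuous φ := continuous_iff_continuousAt.2 fun x => (h1 x).continuousAt
  have hi := intervalIntegrable_mul hV hc lam
  refine ⟨ψ, h1, ?_, fun x hx => ?_⟩
  · have : ψ = fun y => ψ 0 + ∫ t in (0 : ℝ)..y, ((V t : ℂ) - lam) * φ t := by
      funext y; rw [← h2]; ring
    rw [this]
    exact continuous_const.add (intervalIntegral.continuous_primitive hi 0)
  · have : ψ = fun y => ψ x + ∫ t in x..y, ((V t : ℂ) - lam) * φ t := by
      funext y; rw [← h2]; ring
    rw [this]
    refine HasDerivAt.const_add _ (intervalIntegral.integral_hasDerivAt_right (hi x x) ?_ ?_)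
    · have hm : Measurable fun t => ((V t : ℂ) - lam) * φ t :=
        ((Complex.measurable_ofReal.comp hVm).sub_const lam).mul hc.measurable
      exact hm.stronglyMeasurable.stronglyMeasurableAtFilter
    · exact ((Complex.continuous_ofReal.continuousAt.comp (hVc x hx)).sub
        continuousAt_const).mul hc.continuousAt

/-- The Wronskian of solutions for two energies. -/
lemma wronskian_sub {lam₁ lam₂ : ℂ} {φ₁ ψ₁ φ₂ ψ₂ : ℝ → ℂ} (hS : S.Countable)
    (h₁ : SolvesOff S V lam₁ φ₁ ψ₁) (h₂ : SolvesOff S V lam₂ φ₂ ψ₂) (x y : ℝ) :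
    (φ₁ y * ψ₂ y - ψ₁ y * φ₂ y) - (φ₁ x * ψ₂ x - ψ₁ x * φ₂ x) =
      (lam₁ - lam₂) * ∫ t in x..y, φ₁ t * φ₂ t := by
  rw [← intervalIntegral.integral_const_mul]
  refine (integral_eq_of_hasDerivAt_off_countable (fun t => φ₁ t * ψ₂ t - ψ₁ t * φ₂ t) _ hS
    ?_ (fun t ht => ?_) ?_).symm
  · exact ((h₁.continuous.mul h₂.continuous_deriv).sub
      (h₁.continuous_deriv.mul h₂.continuous)).continuousOn
  · refine (((h₁.hasDerivAt t).fun_mul (h₂.hasDerivAt_deriv t ht.2)).fun_sub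
      ((h₁.hasDerivAt_deriv t ht.2).fun_mul (h₂.hasDerivAt t))).congr_deriv ?_
    ring
  · exact (continuous_const.mul (h₁.continuous.mul h₂.continuous)).intervalIntegrable _ _

lemma wronskian_const {φ₁ ψ₁ φ₂ ψ₂ : ℝ → ℂ} (hS : S.Countable)
    (h₁ : SolvesOff S V lam φ₁ ψ₁) (h₂ : SolvesOff S V lam φ₂ ψ₂) (x y : ℝ) :
    φ₁ y * ψ₂ y - ψ₁ y * φ₂ y = φ₁ x * ψ₂ x - ψ₁ x * φ₂ x := by
  have := wronskian_sub hS h₁ h₂ x y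
  rw [sub_self, zero_mul] at this
  exact sub_eq_zero.1 this

lemma add_smul {φ₁ ψ₁ φ₂ ψ₂ : ℝ → ℂ} (h₁ : SolvesOff S V lam φ₁ ψ₁)
    (h₂ : SolvesOff S V lam φ₂ ψ₂) (α β : ℂ) :
    SolvesOff S V lam (fun x => α * φ₁ x + β * φ₂ x) (fun x => α * ψ₁ x + β * ψ₂ x) where
  hasDerivAt x := ((h₁.hasDerivAt x).const_mul α).fun_add ((h₂.hasDerivAt x).const_mul β)
  continuous_deriv :=
    (h₁.continuous_deriv.const_mul α).add (h₂.continuous_deriv.const_mul β)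
  hasDerivAt_deriv x hx := by
    refine (((h₁.hasDerivAt_deriv x hx).const_mul α).fun_add
      ((h₂.hasDerivAt_deriv x hx).const_mul β)).congr_deriv ?_
    ring

end SolvesOff

/-! ### Gluing solutions at a jump of the potential -/

lemma hasDerivAt_ite_le {f g f' g' : ℝ → ℂ} {c x : ℝ} (hf : c ≤ x → HasDerivAt f (f' x) x)
    (hg : x ≤ c → HasDerivAt g (g' x) x) (hfg : f c = g c) (hfg' : x = c → f' c = g' c) :
    HasDerivAt (fun x => if c ≤ x then f x else g x) (if c ≤ x then f' x else g' x) x := by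
  rcases lt_trichotomy x c with h | h | h
  · rw [if_neg (not_le.2 h)]
    refine (hg h.le).congr_of_eventuallyEq ?_
    filter_upwards [Iio_mem_nhds h] with y hy
    rw [if_neg (not_le.2 hy)]
  · subst h
    rw [if_pos le_rfl, ← hasDerivWithinAt_univ, ← Set.Iic_union_Ici (a := x)]
    refine HasDerivWithinAt.union ?_ ?_
    · rw [hfg' rfl]
      refine (hg le_rfl).hasDerivWithinAt.congr (fun y hy => ?_) (by simp [hfg])
      rcases eq_or_lt_of_le (Set.mem_Iic.1 hy) with h | h
      · simp [h, hfg]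
      · rw [if_neg (not_le.2 h)]
    · exact (hf le_rfl).hasDerivWithinAt.congr (fun y hy => if_pos hy) (if_pos le_rfl)
  · rw [if_pos h.le]
    refine (hf h.le).congr_of_eventuallyEq ?_
    filter_upwards [Ioi_mem_nhds h] with y hy
    rw [if_pos (Set.mem_Ioi.1 hy).le]

/-- The function that agrees with `φ` on `[c, ∞)` and solves `y'' = -z y` on `(-∞, c]`, when `ψ`
is the derivative of `φ`. -/
def extendLeft (z : ℂ) (c : ℝ) (φ ψ : ℝ → ℂ) (x : ℝ) : ℂ :=
  if c ≤ x then φ x else waveCos z (x - c) * φ c + waveSin z (x - c) * ψ c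

/-- The derivative of `extendLeft z c φ ψ`. -/
def extendLeftDeriv (z : ℂ) (c : ℝ) (φ ψ : ℝ → ℂ) (x : ℝ) : ℂ :=
  if c ≤ x then ψ x else -z * waveSin z (x - c) * φ c + waveCos z (x - c) * ψ c

lemma extendLeft_of_le {z : ℂ} {c : ℝ} {φ ψ : ℝ → ℂ} {x : ℝ} (h : c ≤ x) :
    extendLeft z c φ ψ x = φ x ∧ extendLeftDeriv z c φ ψ x = ψ x :=
  ⟨if_pos h, if_pos h⟩

lemma extendLeft_of_ge {z : ℂ} {c : ℝ} {φ ψ : ℝ → ℂ} {x : ℝ} (h : x ≤ c) :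
    extendLeft z c φ ψ x = waveCos z (x - c) * φ c + waveSin z (x - c) * ψ c ∧
      extendLeftDeriv z c φ ψ x =
        -z * waveSin z (x - c) * φ c + waveCos z (x - c) * ψ c := by
  rcases eq_or_lt_of_le h with rfl | h
  · simp [extendLeft, extendLeftDeriv]
  · exact ⟨if_neg (not_le.2 h), if_neg (not_le.2 h)⟩

lemma continuous_extendLeft {Z : ℂ → ℂ} (hZ : Continuous Z) (c : ℝ) {φ ψ : ℂ → ℝ → ℂ}
    (hφ : Continuous fun x : ℂ × ℝ => φ x.1 x.2) (hψ : Continuous fun x : ℂ × ℝ => ψ x.1 x.2) :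
    (Continuous fun x : ℂ × ℝ => extendLeft (Z x.1) c (φ x.1) (ψ x.1) x.2) ∧
      Continuous fun x : ℂ × ℝ => extendLeftDeriv (Z x.1) c (φ x.1) (ψ x.1) x.2 := by
  have hm : Continuous fun x : ℂ × ℝ => (Z x.1, x.2 - c) := by fun_prop
  have hC := continuous_waveCos.comp hm
  have hS := continuous_waveSin.comp hm
  have hφc : Continuous fun x : ℂ × ℝ => φ x.1 c :=
    hφ.comp (by fun_prop : Continuous fun x : ℂ × ℝ => (x.1, c))
  have hψc : Continuous fun x : ℂ × ℝ => ψ x.1 c :=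
    hψ.comp (by fun_prop : Continuous fun x : ℂ × ℝ => (x.1, c))
  have hZ' : Continuous fun x : ℂ × ℝ => -Z x.1 := by fun_prop
  constructor
  · refine hφ.if_le ((hC.mul hφc).add (hS.mul hψc)) continuous_const continuous_snd ?_
    rintro ⟨k, x⟩ rfl
    simp
  · refine hψ.if_le (((hZ'.mul hS).mul hφc).add (hC.mul hψc)) continuous_const continuous_snd ?_
    rintro ⟨k, x⟩ rfl
    simp

/-- Since `c` lies in the exceptional set, only the values and first derivatives have to match at
`c`; this holds by the initial values of `waveCos` and `waveSin`. -/
lemma SolvesOff.extendLeft {S : Set ℝ} {V W : ℝ → ℝ} {lam : ℂ} {φ ψ : ℝ → ℂ} {c v : ℝ}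
    (h : SolvesOff S V lam φ ψ) (hc : c ∈ S) (hr : ∀ x, c < x → W x = V x)
    (hl : ∀ x, x < c → W x = v) :
    SolvesOff S W lam (extendLeft (lam - v) c φ ψ) (extendLeftDeriv (lam - v) c φ ψ) := by
  have hC : ∀ z x, HasDerivAt (fun x => waveCos z (x - c)) (-z * waveSin z (x - c)) x :=
    fun z x => (waveCos_hasDerivAt z (x - c)).comp_sub_const x c
  have hS : ∀ z x, HasDerivAt (fun x => waveSin z (x - c)) (waveCos z (x - c)) x :=
    fun z x => (waveSin_hasDerivAt z (x - c)).comp_sub_const x c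
  refine ⟨fun x => ?_, ?_, fun x hx => ?_⟩
  · refine hasDerivAt_ite_le (f' := ψ)
      (g' := fun x => -(lam - v) * waveSin (lam - v) (x - c) * φ c +
        waveCos (lam - v) (x - c) * ψ c) (fun _ => h.hasDerivAt x)
      (fun _ => ((hC _ x).mul_const _).fun_add ((hS _ x).mul_const _)) ?_ (fun _ => ?_) <;> simp
  · have := (continuous_extendLeft (Z := fun _ => lam - v) continuous_const c
      (φ := fun _ => φ) (ψ := fun _ => ψ) (h.continuous.comp continuous_snd)
      (h.continuous_deriv.comp continuous_snd)).2
    exact this.comp (by fun_prop : Continuous fun x : ℝ => ((0 : ℂ), x))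
  · have hxc : x ≠ c := fun h => hx (h ▸ hc)
    refine (hasDerivAt_ite_le (f' := fun x => ((V x : ℂ) - lam) * φ x)
      (g' := fun x => -(lam - v) * waveCos (lam - v) (x - c) * φ c +
        -(lam - v) * waveSin (lam - v) (x - c) * ψ c)
      (fun _ => h.hasDerivAt_deriv x hx) (fun _ => ?_) (by simp)
      (fun h => absurd h hxc)).congr_deriv ?_
    · exact (((hS _ x).const_mul _).mul_const _).fun_add ((hC _ x).mul_const _)
    · rcases lt_or_gt_of_ne hxc with h1 | h1
      · rw [if_neg (not_le.2 h1), hl x h1, (extendLeft_of_ge h1.le).1]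
        ring
      · rw [if_pos h1.le, hr x h1, (extendLeft_of_le h1.le).1]

/-! ### Block potentials -/

/-- The first `n` blocks have positive widths. -/
def Increasing (b : ℕ → ℝ) (n : ℕ) : Prop := ∀ j, 1 ≤ j → j ≤ n → b (j - 1) < b j

lemma Increasing.mono {b : ℕ → ℝ} {m n : ℕ} (h : Increasing b n) (hmn : m ≤ n) :
    Increasing b m := fun j h1 h2 => h j h1 (h2.trans hmn)

lemma Increasing.le {b : ℕ → ℝ} {n : ℕ} (h : Increasing b n) :
    ∀ {i j : ℕ}, i ≤ j → j ≤ n → b i ≤ b j := by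
  intro i j hij
  induction j, hij using Nat.le_induction with
  | base => intro _; exact le_rfl
  | succ j _ ih =>
    intro hj
    exact (ih (by omega)).trans (h (j + 1) (by omega) hj).le

/-- The jumps of the block potentials with endpoints `b`. -/
def jumps (b : ℕ → ℝ) : Set ℝ := Set.range fun j => -b j

lemma countable_jumps (b : ℕ → ℝ) : (jumps b).Countable := Set.countable_range _

lemma measurable_blocks (a b : ℕ → ℝ) (n : ℕ) : Measurable (blocks a b n) := by
  unfold blocks
  exact Finset.measurable_sum _ fun j _ => measurable_const.indicator measurableSet_Ico

lemma intervalIntegrable_blocks (a b : ℕ → ℝ) (n : ℕ) (x y : ℝ) :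
    IntervalIntegrable (blocks a b n) volume x y := by
  refine Integrable.intervalIntegrable ?_
  unfold blocks
  refine integrable_finsetSum _ fun j _ => ?_
  rw [integrable_indicator_iff measurableSet_Ico]
  exact integrableOn_const (by simp)

lemma continuousAt_blocks (a b : ℕ → ℝ) (n : ℕ) {x : ℝ} (hx : x ∉ jumps b) :
    ContinuousAt (blocks a b n) x := by
  unfold blocks
  refine tendsto_finsetSum _ fun j _ => ?_
  refine ContinuousOn.continuousAt_indicator continuous_const.continuousOn fun h => hx ?_
  by_cases hj : -b j < -b (j - 1)
  · rw [frontier_Ico hj] at h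
    rcases h with h | h
    · exact ⟨j, h.symm⟩
    · exact ⟨j - 1, h.symm⟩
  · rw [Set.Ico_eq_empty hj, frontier_empty] at h
    exact absurd h (by simp)

lemma blocks_succ (a b : ℕ → ℝ) (n : ℕ) (x : ℝ) :
    blocks a b (n + 1) x = blocks a b n x +
      (Set.Ico (-b (n + 1)) (-b n)).indicator (fun _ => -(a (n + 1)) ^ 2) x := by
  simp [blocks, Finset.sum_Icc_succ_top]

lemma blocks_eq_zero {a b : ℕ → ℝ} {n : ℕ} (hb : Increasing b n) {x : ℝ} (hx : x < -b n) :
    blocks a b n x = 0 := by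
  unfold blocks
  refine Finset.sum_eq_zero fun j hj => Set.indicator_of_notMem (fun h => ?_) _
  have := hb.le (Finset.mem_Icc.1 hj).2 le_rfl
  have := h.1
  linarith

/-- A single well is the case of one block, so its reflection coefficient needs no separate
treatment. -/
lemma well_eq_blocks (a h : ℝ) :
    well a h = blocks (fun _ => a) (fun j => if j = 0 then 0 else h) 1 := by
  funext x
  simp [well, blocks]

lemma blocks_one_eq_well {a b : ℕ → ℝ} (hb0 : b 0 = 0) :
    blocks a b 1 = well (a 1) (b 1 - b 0) := by
  funext x
  simp [well, blocks, hb0]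

/-! ### The Jost solution at the left end -/

/-- The value and the derivative at `-b n` of the solution for the first `n` blocks that is equal
to `e^{ikx}` on `[0, ∞)`. -/
def jostData (a b : ℕ → ℝ) : ℕ → ℂ → ℂ × ℂ
  | 0, k => (1, Complex.I * k)
  | n + 1, k =>
    (waveCos (k ^ 2 + a (n + 1) ^ 2) (b (n + 1) - b n) * (jostData a b n k).1 -
        waveSin (k ^ 2 + a (n + 1) ^ 2) (b (n + 1) - b n) * (jostData a b n k).2,
      (k ^ 2 + a (n + 1) ^ 2) * waveSin (k ^ 2 + a (n + 1) ^ 2) (b (n + 1) - b n) *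
          (jostData a b n k).1 +
        waveCos (k ^ 2 + a (n + 1) ^ 2) (b (n + 1) - b n) * (jostData a b n k).2)

/-- The coefficient of `e^{ik(x + b n)}` on the left of all blocks in the Jost solution, times
`2 i k`. -/
def jostD (a b : ℕ → ℝ) (n : ℕ) (k : ℂ) : ℂ :=
  Complex.I * k * (jostData a b n k).1 + (jostData a b n k).2

/-- The coefficient of `e^{-ik(x + b n)}` on the left of all blocks in the Jost solution, times
`2 i k`. -/
def jostG (a b : ℕ → ℝ) (n : ℕ) (k : ℂ) : ℂ :=
  Complex.I * k * (jostData a b n k).1 - (jostData a b n k).2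

/-- The function `jostD` of a single well. -/
def blockD (a h : ℝ) (k : ℂ) : ℂ :=
  2 * Complex.I * k * waveCos (k ^ 2 + a ^ 2) h +
    (2 * k ^ 2 + a ^ 2) * waveSin (k ^ 2 + a ^ 2) h

/-- The function `jostG` of a single well. -/
def blockE (a h : ℝ) (k : ℂ) : ℂ := -(a : ℂ) ^ 2 * waveSin (k ^ 2 + a ^ 2) h

lemma blockE_neg (a h : ℝ) (k : ℂ) : blockE a h (-k) = blockE a h k := by
  simp [blockE]

/-- This is `waveCos_sq_add` in disguise. It shows that away from `k = 0` a zero of `blockD` at `k`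
or `-k` is never a zero of `blockE`. -/
lemma blockD_mul_neg (a h : ℝ) (k : ℂ) :
    blockD a h k * blockD a h (-k) - blockE a h k ^ 2 = 4 * k ^ 2 := by
  have h1 := waveCos_sq_add (k ^ 2 + (a : ℂ) ^ 2) h
  simp only [blockD, blockE, neg_sq]
  linear_combination (4 * k ^ 2) * h1 -
    4 * k ^ 2 * (waveCos (k ^ 2 + (a : ℂ) ^ 2) h) ^ 2 * (Complex.I_sq)

section
variable (a b : ℕ → ℝ) (n : ℕ) (k : ℂ)

lemma jostData_fst : 2 * (Complex.I * k) * (jostData a b n k).1 =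
    jostD a b n k + jostG a b n k := by
  simp only [jostD, jostG]; ring

/-- With `jostG_succ` this is the transfer matrix of one more well in the basis of exponentials. The
factor `2ik` stays on the left so that no division occurs. -/
lemma jostD_succ : 2 * Complex.I * k * jostD a b (n + 1) k =
    jostD a b n k * blockD (a (n + 1)) (b (n + 1) - b n) k -
      jostG a b n k * blockE (a (n + 1)) (b (n + 1) - b n) k := by
  simp only [jostD, jostG, blockD, blockE, jostData]
  linear_combination (2 * k ^ 2 * waveSin (k ^ 2 + (a (n + 1) : ℂ) ^ 2) (b (n + 1) - b n) *
    (-(jostData a b n k).2)) * Complex.I_sq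

lemma jostG_succ : 2 * Complex.I * k * jostG a b (n + 1) k =
    jostD a b n k * blockE (a (n + 1)) (b (n + 1) - b n) k -
      jostG a b n k * blockD (a (n + 1)) (b (n + 1) - b n) (-k) := by
  simp only [jostD, jostG, blockD, blockE, jostData, neg_sq]
  linear_combination (2 * k ^ 2 * waveSin (k ^ 2 + (a (n + 1) : ℂ) ^ 2) (b (n + 1) - b n) *
    (-(jostData a b n k).2)) * Complex.I_sq

/-- The Wronskian of the Jost solutions for `k` and `-k` at `-b n`; each block acts on it by a
matrix of determinant 1. -/
lemma jostData_wronskian : (jostData a b n k).1 * (jostData a b n (-k)).2 -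
    (jostData a b n k).2 * (jostData a b n (-k)).1 = -2 * Complex.I * k := by
  induction n with
  | zero => simp [jostData]; ring
  | succ n ih =>
    have h1 := waveCos_sq_add (k ^ 2 + (a (n + 1) : ℂ) ^ 2) (b (n + 1) - b n)
    simp only [jostData, neg_sq]
    linear_combination (waveCos (k ^ 2 + (a (n + 1) : ℂ) ^ 2) (b (n + 1) - b n) ^ 2 +
      (k ^ 2 + (a (n + 1) : ℂ) ^ 2) *
        waveSin (k ^ 2 + (a (n + 1) : ℂ) ^ 2) (b (n + 1) - b n) ^ 2) * ih +
      (-2 * Complex.I * k) * h1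

/-- At a zero of `jostD` this makes `jostG` nonzero at both `k` and `-k` and fixes their product. -/
lemma jostD_mul_neg : jostD a b n k * jostD a b n (-k) - jostG a b n k * jostG a b n (-k) =
    4 * k ^ 2 := by
  have h := jostData_wronskian a b n k
  simp only [jostD, jostG]
  linear_combination 2 * Complex.I * k * h - 4 * k ^ 2 * Complex.I_sq

lemma jostD_one : jostD a b 1 k = blockD (a 1) (b 1 - b 0) k := by
  simp only [jostD, blockD, jostData]
  linear_combination (-k ^ 2 * waveSin (k ^ 2 + (a (0 + 1) : ℂ) ^ 2) (b (0 + 1) - b 0)) *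
    Complex.I_sq

lemma jostG_one : jostG a b 1 k = blockE (a 1) (b 1 - b 0) k := by
  simp only [jostG, blockE, jostData]
  linear_combination (-k ^ 2 * waveSin (k ^ 2 + (a (0 + 1) : ℂ) ^ 2) (b (0 + 1) - b 0)) *
    Complex.I_sq

lemma differentiable_wave_block (a h : ℝ) :
    Differentiable ℂ (fun k : ℂ => waveCos (k ^ 2 + (a : ℂ) ^ 2) h) ∧
      Differentiable ℂ (fun k : ℂ => waveSin (k ^ 2 + (a : ℂ) ^ 2) h) :=
  ⟨(differentiable_waveCos h).comp (by fun_prop), (differentiable_waveSin h).comp (by fun_prop)⟩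

lemma differentiable_jostData :
    Differentiable ℂ (fun k => (jostData a b n k).1) ∧
      Differentiable ℂ (fun k => (jostData a b n k).2) := by
  induction n with
  | zero => exact ⟨by simp [jostData], by simp only [jostData]; fun_prop⟩
  | succ n ih =>
    obtain ⟨hC, hS⟩ := differentiable_wave_block (a (n + 1)) (b (n + 1) - b n)
    obtain ⟨h1, h2⟩ := ih
    exact ⟨(hC.mul h1).sub (hS.mul h2),
      (((by fun_prop : Differentiable ℂ fun k : ℂ => k ^ 2 + (a (n + 1) : ℂ) ^ 2).mul hS).mul
        h1).add (hC.mul h2)⟩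

lemma differentiable_jostD : Differentiable ℂ (jostD a b n) := by
  obtain ⟨h1, h2⟩ := differentiable_jostData a b n
  unfold jostD
  fun_prop

lemma differentiable_jostG : Differentiable ℂ (jostG a b n) := by
  obtain ⟨h1, h2⟩ := differentiable_jostData a b n
  unfold jostG
  fun_prop

lemma differentiable_blockD (a h : ℝ) : Differentiable ℂ (blockD a h) := by
  obtain ⟨h1, h2⟩ := differentiable_wave_block a h
  unfold blockD
  fun_prop

lemma differentiable_blockE (a h : ℝ) : Differentiable ℂ (blockE a h) := by
  obtain ⟨h1, h2⟩ := differentiable_wave_block a h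
  unfold blockE
  fun_prop

end

/-! ### The Jost solution on the line -/

/-- `F k` is the solution for the first `n` blocks and the energy `k ^ 2` that is equal to
`e^{ikx}` on `[0, ∞)`, and `F' k` is its derivative. -/
structure IsJostFamily (a b : ℕ → ℝ) (n : ℕ) (F F' : ℂ → ℝ → ℂ) : Prop where
  continuous : Continuous fun x : ℂ × ℝ => F x.1 x.2
  continuous_deriv : Continuous fun x : ℂ × ℝ => F' x.1 x.2
  solves : ∀ k, SolvesOff (jumps b) (blocks a b n) (k ^ 2) (F k) (F' k)
  right : ∀ k x, 0 ≤ x → F k x = Complex.exp (Complex.I * k * x) ∧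
    F' k x = Complex.I * k * Complex.exp (Complex.I * k * x)
  left : ∀ k x, x ≤ -b n →
    F k x = waveCos (k ^ 2) (x + b n) * (jostData a b n k).1 +
        waveSin (k ^ 2) (x + b n) * (jostData a b n k).2 ∧
      F' k x = -k ^ 2 * waveSin (k ^ 2) (x + b n) * (jostData a b n k).1 +
        waveCos (k ^ 2) (x + b n) * (jostData a b n k).2

lemma hasDerivAt_cexp_mul_ofReal (w : ℂ) (x : ℝ) :
    HasDerivAt (fun x : ℝ => Complex.exp (w * x)) (w * Complex.exp (w * x)) x := by
  have h1 : HasDerivAt (fun t : ℝ => w * (t : ℂ)) w x := by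
    simpa using (Complex.ofRealCLM.hasDerivAt (x := x)).const_mul w
  exact h1.cexp.congr_deriv (by ring)

lemma exists_isJostFamily (a : ℕ → ℝ) {b : ℕ → ℝ} (hb0 : b 0 = 0) {n : ℕ} (hb : Increasing b n) :
    ∃ F F', IsJostFamily a b n F F' := by
  induction n with
  | zero =>
    refine ⟨fun k x => Complex.exp (Complex.I * k * x),
      fun k x => Complex.I * k * Complex.exp (Complex.I * k * x), ?_, ?_, fun k => ⟨?_, ?_, ?_⟩,
      fun k x _ => ⟨rfl, rfl⟩, fun k x _ => ?_⟩
    · fun_prop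
    · fun_prop
    · exact fun x => hasDerivAt_cexp_mul_ofReal (Complex.I * k) x
    · fun_prop
    · intro x _
      refine ((hasDerivAt_cexp_mul_ofReal (Complex.I * k) x).const_mul
        (Complex.I * k)).congr_deriv ?_
      simp only [blocks, Finset.Icc_eq_empty_of_lt zero_lt_one, Finset.sum_empty,
        Complex.ofReal_zero]
      linear_combination k ^ 2 * Complex.exp (Complex.I * k * x) * Complex.I_sq
    · simp only [hb0, add_zero, jostData]
      rw [← wave_sq k x]
      constructor
      · ring
      · linear_combination k ^ 2 * waveSin (k ^ 2) x * Complex.I_sq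
  | succ n ih =>
    obtain ⟨F, F', h⟩ := ih (hb.mono n.le_succ)
    have hlt : b n < b (n + 1) := hb (n + 1) (by omega) le_rfl
    have h0 : 0 ≤ b n := hb0 ▸ hb.le (Nat.zero_le n) n.le_succ
    set α : ℝ := -(a (n + 1)) ^ 2 with hα
    -- Each block needs two extensions: at `-b n` into the constant potential `α` on the whole left
    -- half-line, which is `W`, and at `-b (n + 1)` back into the free region.
    let W : ℝ → ℝ := fun x => if x < -b n then α else blocks a b n x
    let F₁ : ℂ → ℝ → ℂ := fun k => extendLeft (k ^ 2 - α) (-b n) (F k) (F' k)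
    let F₁' : ℂ → ℝ → ℂ := fun k => extendLeftDeriv (k ^ 2 - α) (-b n) (F k) (F' k)
    have hs₁ : ∀ k, SolvesOff (jumps b) W (k ^ 2) (F₁ k) (F₁' k) := fun k =>
      (h.solves k).extendLeft ⟨n, rfl⟩ (fun x hx => if_neg (not_lt.2 hx.le)) (fun x hx => if_pos hx)
    have hc₁ := continuous_extendLeft (Z := fun k => k ^ 2 - α) (by fun_prop) (-b n)
      h.continuous h.continuous_deriv
    have hc₂ := continuous_extendLeft (Z := fun k => k ^ 2 - ((0 : ℝ) : ℂ)) (by fun_prop)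
      (-b (n + 1)) (φ := F₁) (ψ := F₁') hc₁.1 hc₁.2
    have hd : ∀ k, F₁ k (-b (n + 1)) = (jostData a b (n + 1) k).1 ∧
        F₁' k (-b (n + 1)) = (jostData a b (n + 1) k).2 := by
      intro k
      have h1 := extendLeft_of_ge (z := k ^ 2 - α) (c := -b n) (φ := F k) (ψ := F' k)
        (x := -b (n + 1)) (by linarith)
      have h2 := h.left k (-b n) le_rfl
      rw [neg_add_cancel] at h2
      simp only [waveCos_zero, waveSin_zero, one_mul, zero_mul, add_zero, mul_zero,
        zero_add] at h2
      have h3 : -b (n + 1) - -b n = -(b (n + 1) - b n) := by ring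
      have h4 : k ^ 2 - (α : ℂ) = k ^ 2 + (a (n + 1) : ℂ) ^ 2 := by
        rw [hα]; push_cast; ring
      rw [h2.1, h2.2, h3, h4, waveCos_neg_right, waveSin_neg_right] at h1
      simp only [F₁, F₁', jostData, h4]
      rw [h1.1, h1.2]
      constructor <;> ring
    refine ⟨fun k => extendLeft (k ^ 2 - ((0 : ℝ) : ℂ)) (-b (n + 1)) (F₁ k) (F₁' k),
      fun k => extendLeftDeriv (k ^ 2 - ((0 : ℝ) : ℂ)) (-b (n + 1)) (F₁ k) (F₁' k),
      hc₂.1, hc₂.2, fun k => ?_, fun k x hx => ?_, fun k x hx => ?_⟩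
    · refine (hs₁ k).extendLeft (v := 0) ⟨n + 1, rfl⟩ (fun x hx => ?_)
        (fun x hx => blocks_eq_zero hb hx)
      simp only [W]
      rw [blocks_succ]
      split_ifs with hxn
      · have hm : x ∈ Set.Ico (-b (n + 1)) (-b n) := ⟨hx.le, hxn⟩
        rw [blocks_eq_zero (hb.mono n.le_succ) hxn, Set.indicator_of_mem hm, zero_add]
      · rw [Set.indicator_of_notMem (fun h => hxn h.2), add_zero]
    · have e₂ := extendLeft_of_le (z := k ^ 2 - ((0 : ℝ) : ℂ)) (c := -b (n + 1)) (φ := F₁ k)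
        (ψ := F₁' k) (x := x) (by linarith)
      have e₁ := extendLeft_of_le (z := k ^ 2 - α) (c := -b n) (φ := F k) (ψ := F' k) (x := x)
        (by linarith)
      exact ⟨e₂.1.trans (e₁.1.trans (h.right k x hx).1), e₂.2.trans (e₁.2.trans (h.right k x hx).2)⟩
    · have e₂ := extendLeft_of_ge (z := k ^ 2 - ((0 : ℝ) : ℂ)) (φ := F₁ k) (ψ := F₁' k) hx
      rw [(hd k).1, (hd k).2, sub_neg_eq_add] at e₂
      simpa only [Complex.ofReal_zero, sub_zero] using e₂

/-! ### Asymptotic coefficients and the formulas for the reflection coefficients -/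

/-- The two exponentials are linearly independent near every point. -/
lemma exp_coeff_eq_zero {k A B : ℂ} (hk : k ≠ 0) {x₀ : ℝ}
    (h : ∀ᶠ x : ℝ in 𝓝 x₀,
      A * Complex.exp (Complex.I * k * x) + B * Complex.exp (-(Complex.I * k * x)) = 0) :
    A = 0 ∧ B = 0 := by
  have h0 := h.self_of_nhds
  have hd : HasDerivAt (fun x : ℝ => A * Complex.exp (Complex.I * k * x) +
      B * Complex.exp (-(Complex.I * k * x)))
      (A * (Complex.I * k * Complex.exp (Complex.I * k * x₀)) +
        B * (-(Complex.I * k) * Complex.exp (-(Complex.I * k) * x₀))) x₀ := by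
    have h2 := hasDerivAt_cexp_mul_ofReal (-(Complex.I * k)) x₀
    simp only [← neg_mul]
    simp only [← neg_mul] at h2
    exact ((hasDerivAt_cexp_mul_ofReal (Complex.I * k) x₀).const_mul A).fun_add (h2.const_mul B)
  have h1 := hd.unique ((hasDerivAt_const x₀ (0 : ℂ)).congr_of_eventuallyEq h)
  have hIk : Complex.I * k ≠ 0 := mul_ne_zero Complex.I_ne_zero hk
  rw [neg_mul (Complex.I * k) (x₀ : ℂ)] at h1
  have hA : 2 * (Complex.I * k) * (A * Complex.exp (Complex.I * k * x₀)) = 0 := by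
    linear_combination h1 + Complex.I * k * h0
  have hB : 2 * (Complex.I * k) * (B * Complex.exp (-(Complex.I * k * x₀))) = 0 := by
    linear_combination -h1 + Complex.I * k * h0
  simp only [mul_eq_zero, Complex.exp_ne_zero, hIk, OfNat.ofNat_ne_zero, or_false, false_or]
    at hA hB
  have := Complex.I_ne_zero
  tauto

lemma exp_coeff_eq_zero_atTop {k A B : ℂ} (hk : k ≠ 0)
    (h : ∀ᶠ x : ℝ in atTop,
      A * Complex.exp (Complex.I * k * x) + B * Complex.exp (-(Complex.I * k * x)) = 0) :
    A = 0 ∧ B = 0 := by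
  obtain ⟨X, hX⟩ := eventually_atTop.1 h
  refine exp_coeff_eq_zero hk (x₀ := X + 1) ?_
  filter_upwards [Ioi_mem_nhds (lt_add_one X)] with x hx using hX x (le_of_lt hx)

lemma exp_coeff_eq_zero_atBot {k A B : ℂ} (hk : k ≠ 0)
    (h : ∀ᶠ x : ℝ in atBot,
      A * Complex.exp (Complex.I * k * x) + B * Complex.exp (-(Complex.I * k * x)) = 0) :
    A = 0 ∧ B = 0 := by
  obtain ⟨X, hX⟩ := eventually_atBot.1 h
  refine exp_coeff_eq_zero hk (x₀ := X - 1) ?_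
  filter_upwards [Iio_mem_nhds (sub_one_lt X)] with x hx using hX x (le_of_lt hx)

namespace IsJostFamily

variable {a b : ℕ → ℝ} {n : ℕ} {F F' : ℂ → ℝ → ℂ}

lemma isSolution (h : IsJostFamily a b n F F') (α β k : ℂ) :
    IsSolution (blocks a b n) (k ^ 2) (fun x => α * F (-k) x + β * F k x) := by
  have h1 := h.solves (-k)
  rw [neg_sq] at h1
  exact (h1.add_smul (h.solves k) α β).isSolution (countable_jumps b)
    (intervalIntegrable_blocks a b n)

/-- Every solution is a combination of the Jost solutions for `k` and `-k`. -/
lemma exists_coeff (h : IsJostFamily a b n F F') {k : ℂ} (hk : k ≠ 0) {φ : ℝ → ℂ}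
    (hφ : IsSolution (blocks a b n) (k ^ 2) φ) :
    ∃ α β, ∀ x, φ x = α * F (-k) x + β * F k x := by
  obtain ⟨ψ, hs⟩ := SolvesOff.of_isSolution hφ (measurable_blocks a b n)
    (intervalIntegrable_blocks a b n) (fun x hx => continuousAt_blocks a b n hx)
  have h1 := h.solves k
  have h2 := h.solves (-k)
  rw [neg_sq] at h2
  have hW : ∀ x, F (-k) x * F' k x - F' (-k) x * F k x = 2 * Complex.I * k := by
    intro x
    rw [SolvesOff.wronskian_const (countable_jumps b) h2 h1 0 x]
    simp only [h.right _ 0 le_rfl]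
    simp; ring
  have hIk : 2 * Complex.I * k ≠ 0 := by simp [hk]
  -- Cramer's rule: the coefficients are Wronskians of `φ` with the two Jost solutions, which may be
  -- evaluated at `0` because they are constant.
  refine ⟨(φ 0 * F' k 0 - ψ 0 * F k 0) / (2 * Complex.I * k),
    -(φ 0 * F' (-k) 0 - ψ 0 * F (-k) 0) / (2 * Complex.I * k), fun x => ?_⟩
  rw [← SolvesOff.wronskian_const (countable_jumps b) hs h1 0 x,
    ← SolvesOff.wronskian_const (countable_jumps b) hs h2 0 x]
  field_simp
  linear_combination (-φ x) * hW x

/-- The Jost solution on the left of all blocks. -/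
lemma left_exp (h : IsJostFamily a b n F F') (k : ℂ) {x : ℝ} (hx : x ≤ -b n) :
    2 * Complex.I * k * F k x =
      jostD a b n k * Complex.exp (Complex.I * k * b n) * Complex.exp (Complex.I * k * x) +
        jostG a b n k * Complex.exp (-(Complex.I * k * b n)) *
          Complex.exp (-(Complex.I * k * x)) := by
  have e1 := wave_sq k (x + b n)
  have e2 := wave_sq (-k) (x + b n)
  rw [neg_sq] at e2
  have e3 : Complex.exp (Complex.I * k * b n) * Complex.exp (Complex.I * k * x) =
      Complex.exp (Complex.I * k * ((x + b n : ℝ) : ℂ)) := by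
    rw [← Complex.exp_add]; congr 1; push_cast; ring
  have e4 : Complex.exp (-(Complex.I * k * b n)) * Complex.exp (-(Complex.I * k * x)) =
      Complex.exp (Complex.I * -k * ((x + b n : ℝ) : ℂ)) := by
    rw [← Complex.exp_add]; congr 1; push_cast; ring
  rw [mul_assoc (jostD a b n k), mul_assoc (jostG a b n k), e3, e4, ← e1, ← e2,
    (h.left k x hx).1]
  simp only [jostD, jostG]
  ring

lemma left_exp_neg (h : IsJostFamily a b n F F') (k : ℂ) {x : ℝ} (hx : x ≤ -b n) :
    -(2 * Complex.I * k) * F (-k) x =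
      jostD a b n (-k) * Complex.exp (-(Complex.I * k * b n)) *
          Complex.exp (-(Complex.I * k * x)) +
        jostG a b n (-k) * Complex.exp (Complex.I * k * b n) *
          Complex.exp (Complex.I * k * x) := by
  have := h.left_exp (-k) hx
  simp only [mul_neg, neg_mul, neg_neg] at this ⊢
  exact this

lemma right_neg (h : IsJostFamily a b n F F') (k : ℂ) {x : ℝ} (hx : 0 ≤ x) :
    F (-k) x = Complex.exp (-(Complex.I * k * x)) := by
  rw [(h.right (-k) x hx).1]; congr 1; ring

/-- A solution that is `α e^{-ikx} + β e^{ikx}` near `+∞` has these coefficients everywhere. -/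
lemma eq_of_atTop (h : IsJostFamily a b n F F') {k : ℂ} (hk : k ≠ 0) {φ : ℝ → ℂ}
    (hφ : IsSolution (blocks a b n) (k ^ 2) φ) {α β : ℂ}
    (hr : ∀ᶠ x : ℝ in atTop, φ x = α * Complex.exp (-(Complex.I * k * x)) +
      β * Complex.exp (Complex.I * k * x)) (x : ℝ) :
    φ x = α * F (-k) x + β * F k x := by
  obtain ⟨α', β', he⟩ := h.exists_coeff hk hφ
  have h0 : ∀ᶠ x : ℝ in atTop, (β' - β) * Complex.exp (Complex.I * k * x) +
      (α' - α) * Complex.exp (-(Complex.I * k * x)) = 0 := by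
    filter_upwards [hr, eventually_ge_atTop (0 : ℝ)] with y hy hy0
    rw [he, h.right_neg k hy0, (h.right k y hy0).1] at hy
    linear_combination hy
  obtain ⟨h1, h2⟩ := exp_coeff_eq_zero_atTop hk h0
  rw [he, sub_eq_zero.1 h1, sub_eq_zero.1 h2]

/-- The behaviour at `+∞` forces the solution to be `F (-k) + ρ F k`. The wave `e^{ikx}` must be
absent on the left, and its coefficient there is proportional to `-jostG (-k) + ρ * jostD k`. -/
lemma isRightReflection_iff (h : IsJostFamily a b n F F') {k : ℂ} (hk : k ≠ 0)
    (hD : jostD a b n k ≠ 0) (ρ : ℂ) :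
    IsRightReflection (blocks a b n) k ρ ↔ ρ = jostG a b n (-k) / jostD a b n k := by
  have hIk : 2 * Complex.I * k ≠ 0 := by simp [hk]
  constructor
  · rintro ⟨φ, τ, hs, hr, hl⟩
    have he := h.eq_of_atTop hk hs (α := 1) (β := ρ) (by simpa using hr)
    have h0 : ∀ᶠ x : ℝ in atBot,
        ((-jostG a b n (-k) + ρ * jostD a b n k) * Complex.exp (Complex.I * k * b n)) *
          Complex.exp (Complex.I * k * x) +
        ((-jostD a b n (-k) + ρ * jostG a b n k) * Complex.exp (-(Complex.I * k * b n)) -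
          2 * Complex.I * k * τ) * Complex.exp (-(Complex.I * k * x)) = 0 := by
      filter_upwards [hl, eventually_le_atBot (-b n)] with x hx hxb
      rw [he] at hx
      linear_combination h.left_exp_neg k hxb - ρ * h.left_exp k hxb +
        2 * Complex.I * k * hx
    have h1 := (exp_coeff_eq_zero_atBot hk h0).1
    have h2 : -jostG a b n (-k) + ρ * jostD a b n k = 0 := by
      simpa [Complex.exp_ne_zero] using h1
    rw [eq_div_iff hD]
    linear_combination h2
  · rintro rfl
    set X := (-jostD a b n (-k) + jostG a b n (-k) / jostD a b n k * jostG a b n k) *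
      Complex.exp (-(Complex.I * k * b n)) with hX
    have hσ : 2 * Complex.I * k * (X / (2 * Complex.I * k)) = X := mul_div_cancel₀ _ hIk
    refine ⟨_, X / (2 * Complex.I * k), h.isSolution 1 (jostG a b n (-k) / jostD a b n k) k, ?_, ?_⟩
    · filter_upwards [eventually_ge_atTop (0 : ℝ)] with x hx
      rw [h.right_neg k hx, (h.right k x hx).1, one_mul]
    · filter_upwards [eventually_le_atBot (-b n)] with x hx
      refine mul_left_cancel₀ hIk ?_
      have h1 := h.left_exp_neg k hx
      have h2 := h.left_exp k hx
      have h3 : jostG a b n (-k) / jostD a b n k * jostD a b n k = jostG a b n (-k) :=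
        div_mul_cancel₀ _ hD
      rw [hX] at hσ
      linear_combination -h1 + jostG a b n (-k) / jostD a b n k * h2 -
        Complex.exp (-(Complex.I * k * x)) * hσ +
        Complex.exp (Complex.I * k * b n) * Complex.exp (Complex.I * k * x) * h3

/-- Here the solution must be `τ F k`; the incoming coefficient 1 on the left fixes `τ`, and the
other coefficient is then `ρ`. The exponential appears because `jostD` and `jostG` refer to the
phase at `-b n`. -/
lemma isLeftReflection_iff (h : IsJostFamily a b n F F') {k : ℂ} (hk : k ≠ 0)
    (hD : jostD a b n k ≠ 0) (ρ : ℂ) :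
    IsLeftReflection (blocks a b n) k ρ ↔
      ρ = jostG a b n k / jostD a b n k * Complex.exp (-(2 * Complex.I * k * b n)) := by
  have hIk : 2 * Complex.I * k ≠ 0 := by simp [hk]
  have hexp : Complex.exp (-(2 * Complex.I * k * b n)) * Complex.exp (Complex.I * k * b n) =
      Complex.exp (-(Complex.I * k * b n)) := by
    rw [← Complex.exp_add]; congr 1; ring
  have hne := Complex.exp_ne_zero (Complex.I * k * b n)
  constructor
  · rintro ⟨φ, τ, hs, hl, hr⟩
    have he := h.eq_of_atTop hk hs (α := 0) (β := τ) (by simpa using hr)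
    have h0 : ∀ᶠ x : ℝ in atBot,
        (τ * jostD a b n k * Complex.exp (Complex.I * k * b n) - 2 * Complex.I * k) *
          Complex.exp (Complex.I * k * x) +
        (τ * jostG a b n k * Complex.exp (-(Complex.I * k * b n)) -
          2 * Complex.I * k * ρ) * Complex.exp (-(Complex.I * k * x)) = 0 := by
      filter_upwards [hl, eventually_le_atBot (-b n)] with x hx hxb
      rw [he] at hx
      linear_combination -τ * h.left_exp k hxb + 2 * Complex.I * k * hx
    obtain ⟨h1, h2⟩ := exp_coeff_eq_zero_atBot hk h0
    rw [← hexp] at h2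
    have h3 : 2 * Complex.I * k * Complex.exp (Complex.I * k * b n) * (ρ * jostD a b n k) =
        2 * Complex.I * k * Complex.exp (Complex.I * k * b n) *
          (jostG a b n k * Complex.exp (-(2 * Complex.I * k * b n))) := by
      linear_combination (-jostD a b n k * Complex.exp (Complex.I * k * b n)) * h2 +
        (jostG a b n k * Complex.exp (-(2 * Complex.I * k * b n)) *
          Complex.exp (Complex.I * k * b n)) * h1
    rw [div_mul_eq_mul_div, eq_div_iff hD]
    exact mul_left_cancel₀ (mul_ne_zero hIk hne) h3
  · rintro rfl
    set τ := 2 * Complex.I * k / (jostD a b n k * Complex.exp (Complex.I * k * b n)) with hτ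
    have hτ' : τ * (jostD a b n k * Complex.exp (Complex.I * k * b n)) = 2 * Complex.I * k :=
      div_mul_cancel₀ _ (mul_ne_zero hD hne)
    refine ⟨_, τ, h.isSolution 0 τ k, ?_, ?_⟩
    · filter_upwards [eventually_le_atBot (-b n)] with x hx
      refine mul_left_cancel₀ hIk ?_
      have h2 := h.left_exp k hx
      rw [← hexp] at h2
      have h3 : jostG a b n k / jostD a b n k * jostD a b n k = jostG a b n k :=
        div_mul_cancel₀ _ hD
      linear_combination τ * h2 + (Complex.exp (Complex.I * k * x) +
        jostG a b n k / jostD a b n k * Complex.exp (-(2 * Complex.I * k * b n)) *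
          Complex.exp (-(Complex.I * k * x))) * hτ' -
        τ * Complex.exp (-(2 * Complex.I * k * b n)) * Complex.exp (Complex.I * k * b n) *
          Complex.exp (-(Complex.I * k * x)) * h3
    · filter_upwards [eventually_ge_atTop (0 : ℝ)] with x hx
      rw [(h.right k x hx).1, zero_mul, zero_add]

end IsJostFamily

lemma rightReflection_blocks (a : ℕ → ℝ) {b : ℕ → ℝ} (hb0 : b 0 = 0) {n : ℕ}
    (hb : Increasing b n) {k : ℂ} (hk : k ≠ 0) (hD : jostD a b n k ≠ 0) :
    rightReflection (blocks a b n) k = jostG a b n (-k) / jostD a b n k := by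
  obtain ⟨F, F', h⟩ := exists_isJostFamily a hb0 hb
  have hex : ∃ ρ, IsRightReflection (blocks a b n) k ρ :=
    ⟨_, (h.isRightReflection_iff hk hD _).2 rfl⟩
  rw [rightReflection, dif_pos hex]
  exact (h.isRightReflection_iff hk hD _).1 hex.choose_spec

lemma leftReflection_blocks (a : ℕ → ℝ) {b : ℕ → ℝ} (hb0 : b 0 = 0) {n : ℕ}
    (hb : Increasing b n) {k : ℂ} (hk : k ≠ 0) (hD : jostD a b n k ≠ 0) :
    leftReflection (blocks a b n) k =
      jostG a b n k / jostD a b n k * Complex.exp (-(2 * Complex.I * k * b n)) := by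
  obtain ⟨F, F', h⟩ := exists_isJostFamily a hb0 hb
  have hex : ∃ ρ, IsLeftReflection (blocks a b n) k ρ :=
    ⟨_, (h.isLeftReflection_iff hk hD _).2 rfl⟩
  rw [leftReflection, dif_pos hex]
  exact (h.isLeftReflection_iff hk hD _).1 hex.choose_spec

lemma rightReflection_well (a : ℝ) {h : ℝ} (hh : 0 < h) {k : ℂ} (hk : k ≠ 0)
    (hD : blockD a h k ≠ 0) : rightReflection (well a h) k = blockE a h k / blockD a h k := by
  have e1 : jostD (fun _ => a) (fun j => if j = 0 then 0 else h) 1 = blockD a h := by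
    funext k; rw [jostD_one]; simp
  have e2 : jostG (fun _ => a) (fun j => if j = 0 then 0 else h) 1 = blockE a h := by
    funext k; rw [jostG_one]; simp
  rw [well_eq_blocks, rightReflection_blocks _ (by simp) _ hk (by rwa [e1]), e1, e2, blockE_neg]
  intro j h1 h2
  obtain rfl : j = 1 := by omega
  simpa using hh

/-! ### Bound states -/

/-- The set where `‖φ‖ ≥ 1` would contain a half-line, while for a square-integrable function it has
finite measure. -/
lemma not_memLp_two_of_tendsto_atTop {φ : ℝ → ℂ}
    (h : Tendsto (fun x => ‖φ x‖) atTop atTop ∨ Tendsto (fun x => ‖φ x‖) atBot atTop) :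
    ¬ MemLp φ 2 volume := by
  intro hφ
  have hi := (memLp_two_iff_integrable_sq_norm hφ.1).1 hφ
  have hlt := hi.measure_norm_ge_lt_top one_pos
  have hle : ∀ x, 1 ≤ ‖φ x‖ → 1 ≤ ‖‖φ x‖ ^ 2‖ := fun x hx => by
    rw [norm_pow, norm_norm]; exact one_le_pow₀ hx
  rcases h with h | h
  · obtain ⟨X, hX⟩ := eventually_atTop.1 (h.eventually_ge_atTop 1)
    have := measure_mono (μ := volume) (s := Set.Ici X) fun x hx => hle x (hX x hx)
    simp only [Real.volume_Ici, top_le_iff] at this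
    exact hlt.ne this
  · obtain ⟨X, hX⟩ := eventually_atBot.1 (h.eventually_ge_atTop 1)
    have := measure_mono (μ := volume) (s := Set.Iic X) fun x hx => hle x (hX x hx)
    simp only [Real.volume_Iic, top_le_iff] at this
    exact hlt.ne this

lemma exp_I_mul_I (κ x : ℝ) :
    Complex.exp (Complex.I * (Complex.I * κ) * x) = (Real.exp (-κ * x) : ℝ) ∧
      Complex.exp (-(Complex.I * (Complex.I * κ) * x)) = (Real.exp (κ * x) : ℝ) := by
  rw [← mul_assoc, Complex.I_mul_I]
  push_cast
  constructor <;> congr 1 <;> ring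

lemma tendsto_norm_exp_atTop {κ : ℝ} (hκ : 0 < κ) {A : ℂ} (hA : A ≠ 0) (B : ℂ) :
    Tendsto (fun x : ℝ => ‖A * (Real.exp (κ * x) : ℝ) + B * (Real.exp (-κ * x) : ℝ)‖)
      atTop atTop := by
  have h1 : Tendsto (fun x : ℝ => ‖A‖ * Real.exp (κ * x) - ‖B‖) atTop atTop :=
    tendsto_atTop_add_const_right _ _
      ((Real.tendsto_exp_atTop.comp (tendsto_id.const_mul_atTop hκ)).const_mul_atTop
        (norm_pos_iff.2 hA))
  refine tendsto_atTop_mono' _ ?_ h1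
  filter_upwards [eventually_ge_atTop (0 : ℝ)] with x hx
  have h2 : ‖B * (Real.exp (-κ * x) : ℝ)‖ ≤ ‖B‖ := by
    rw [norm_mul, Complex.norm_real, Real.norm_eq_abs, Real.abs_exp]
    refine mul_le_of_le_one_right (norm_nonneg _) (Real.exp_le_one_iff.2 ?_)
    nlinarith
  have h3 : ‖A * (Real.exp (κ * x) : ℝ)‖ = ‖A‖ * Real.exp (κ * x) := by
    rw [norm_mul, Complex.norm_real, Real.norm_eq_abs, Real.abs_exp]
  have h4 := norm_sub_norm_le (A * (Real.exp (κ * x) : ℝ)) (-(B * (Real.exp (-κ * x) : ℝ)))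
  rw [norm_neg, sub_neg_eq_add] at h4
  linarith

/-- Continuity of the quotient suffices, so a parameter integral inside `g` need not be
differentiated. -/
lemma hasDerivAt_of_eq_sub_mul {P g : ℂ → ℂ} {z : ℂ} (hg : ContinuousAt g z)
    (h : ∀ k, P k = (k - z) * g k) : HasDerivAt P (g z) z := by
  rw [hasDerivAt_iff_tendsto_slope]
  refine (hg.tendsto.mono_left nhdsWithin_le_nhds).congr' ?_
  filter_upwards [self_mem_nhdsWithin] with k hk
  have : k - z ≠ 0 := sub_ne_zero.2 hk
  rw [slope_def_field, h, h]
  field_simp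
  ring

lemma I_mul_sq (κ : ℝ) : (Complex.I * κ) ^ 2 = ((-κ ^ 2 : ℝ) : ℂ) := by
  rw [mul_pow, Complex.I_sq]; push_cast; ring

namespace IsJostFamily

variable {a b : ℕ → ℝ} {n : ℕ} {F F' : ℂ → ℝ → ℂ} {κ : ℝ}

/-- Square integrability at `+∞` leaves a multiple of `F (iκ)`; at `-∞` the coefficient of the
growing exponential is `jostD`, up to nonzero factors. -/
lemma jostD_eq_zero_of_isBoundState (h : IsJostFamily a b n F F') (hκ : 0 < κ)
    (hs : IsBoundState (blocks a b n) (-κ ^ 2)) : jostD a b n (Complex.I * κ) = 0 := by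
  obtain ⟨-, φ, hφ, hφ0, hL⟩ := hs
  rw [← I_mul_sq] at hφ
  have hk : Complex.I * (κ : ℂ) ≠ 0 := by simp [hκ.ne']
  have hIk : 2 * Complex.I * (Complex.I * κ) ≠ 0 := by simp [hκ.ne']
  obtain ⟨α, β, he⟩ := h.exists_coeff hk hφ
  have hα : α = 0 := by
    by_contra hα
    refine not_memLp_two_of_tendsto_atTop (Or.inl ?_) hL
    refine (tendsto_norm_exp_atTop hκ hα β).congr' ?_
    filter_upwards [eventually_ge_atTop (0 : ℝ)] with x hx
    rw [he, h.right_neg _ hx, (h.right _ x hx).1, (exp_I_mul_I κ x).1, (exp_I_mul_I κ x).2]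
  have hβ : β ≠ 0 := by
    rintro rfl
    exact hφ0 (funext fun x => by simp [he, hα])
  by_contra hD
  refine not_memLp_two_of_tendsto_atTop (Or.inr ?_) hL
  have hA : β * jostD a b n (Complex.I * κ) * Complex.exp (Complex.I * (Complex.I * κ) * b n) /
      (2 * Complex.I * (Complex.I * κ)) ≠ 0 :=
    div_ne_zero (mul_ne_zero (mul_ne_zero hβ hD) (Complex.exp_ne_zero _)) hIk
  refine ((tendsto_norm_exp_atTop hκ hA (β * jostG a b n (Complex.I * κ) *
    Complex.exp (-(Complex.I * (Complex.I * κ) * b n)) /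
      (2 * Complex.I * (Complex.I * κ)))).comp tendsto_neg_atBot_atTop).congr' ?_
  filter_upwards [eventually_le_atBot (-b n)] with x hx
  have h1 := h.left_exp (Complex.I * κ) hx
  rw [(exp_I_mul_I κ x).1, (exp_I_mul_I κ x).2] at h1
  simp only [Function.comp_apply, he, hα, zero_mul, zero_add, mul_neg, neg_mul, neg_neg] at h1 ⊢
  congr 1
  refine mul_left_cancel₀ hIk ?_
  rw [mul_left_comm _ β, h1]
  have hκ' : (κ : ℂ) ≠ 0 := by exact_mod_cast hκ.ne'
  field_simp

lemma eq_left_of_jostD_eq_zero (h : IsJostFamily a b n F F') (hκ : 0 < κ)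
    (hD : jostD a b n (Complex.I * κ) = 0) {x : ℝ} (hx : x ≤ -b n) :
    F (Complex.I * κ) x = (jostData a b n (Complex.I * κ)).1 * (Real.exp (κ * (x + b n)) : ℝ) := by
  have hIk : 2 * Complex.I * (Complex.I * κ) ≠ 0 := by simp [hκ.ne']
  have h1 := h.left_exp (Complex.I * κ) hx
  have h2 := jostData_fst a b n (Complex.I * κ)
  rw [hD, zero_add] at h2
  refine mul_left_cancel₀ hIk ?_
  rw [h1, hD, ← h2, (exp_I_mul_I κ x).2, (exp_I_mul_I κ (b n)).2, mul_add, Real.exp_add]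
  push_cast
  ring

/-- The Jost solution is real on the imaginary axis. -/
lemma conj_eq (h : IsJostFamily a b n F F') (hκ : 0 < κ) (x : ℝ) :
    (starRingEnd ℂ) (F (Complex.I * κ) x) = F (Complex.I * κ) x := by
  have hk : Complex.I * (κ : ℂ) ≠ 0 := by simp [hκ.ne']
  have h1 := h.solves (Complex.I * κ)
  -- The energy `-κ²` and the potential are real, so the conjugate solves the same equation. It also
  -- has the same real asymptotics at `+∞`, and uniqueness applies.
  have hs : SolvesOff (jumps b) (blocks a b n) ((Complex.I * κ) ^ 2)
      (fun x => star (F (Complex.I * κ) x)) (fun x => star (F' (Complex.I * κ) x)) := by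
    refine ⟨fun x => (h1.hasDerivAt x).star, h1.continuous_deriv.star, fun x hx => ?_⟩
    refine (h1.hasDerivAt_deriv x hx).star.congr_deriv ?_
    rw [I_mul_sq, ← Complex.ofReal_sub]
    simp
  have := h.eq_of_atTop hk (hs.isSolution (countable_jumps b) (intervalIntegrable_blocks a b n))
    (α := 0) (β := 1) ?_ x
  · simpa using! this
  · filter_upwards [eventually_ge_atTop (0 : ℝ)] with x hx
    rw [(h.right _ x hx).1, (exp_I_mul_I κ x).1, zero_mul, zero_add, one_mul]
    exact Complex.conj_ofReal _

lemma integrableOn_and_integral_left (h : IsJostFamily a b n F F') (hκ : 0 < κ)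
    (hD : jostD a b n (Complex.I * κ) = 0) :
    IntegrableOn (fun x => ‖F (Complex.I * κ) x‖ ^ 2) (Set.Iic (-b n)) ∧
      ∫ x in Set.Iic (-b n), ‖F (Complex.I * κ) x‖ ^ 2 =
        ‖(jostData a b n (Complex.I * κ)).1‖ ^ 2 / (2 * κ) := by
  have he : Set.EqOn (fun x => ‖F (Complex.I * κ) x‖ ^ 2)
      (fun x => ‖(jostData a b n (Complex.I * κ)).1‖ ^ 2 * Real.exp (2 * κ * b n) *
        Real.exp (2 * κ * x)) (Set.Iic (-b n)) := by
    intro x hx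
    simp only
    rw [h.eq_left_of_jostD_eq_zero hκ hD hx, norm_mul, mul_pow, Complex.norm_real,
      Real.norm_eq_abs, Real.abs_exp, ← Real.exp_nat_mul, mul_assoc, ← Real.exp_add]
    congr 2
    push_cast; ring
  constructor
  · exact (integrableOn_congr_fun he measurableSet_Iic).2
      ((integrableOn_exp_mul_Iic (by linarith) _).const_mul _)
  · rw [setIntegral_congr_fun measurableSet_Iic he, integral_const_mul,
      integral_exp_mul_Iic (by linarith), mul_div_assoc', mul_assoc, ← Real.exp_add]
    simp

lemma integrableOn_and_integral_right (h : IsJostFamily a b n F F') (hκ : 0 < κ) :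
    IntegrableOn (fun x => ‖F (Complex.I * κ) x‖ ^ 2) (Set.Ioi 0) ∧
      ∫ x in Set.Ioi 0, ‖F (Complex.I * κ) x‖ ^ 2 = 1 / (2 * κ) := by
  have he : Set.EqOn (fun x => ‖F (Complex.I * κ) x‖ ^ 2)
      (fun x => Real.exp (-(2 * κ) * x)) (Set.Ioi 0) := by
    intro x hx
    simp only
    rw [(h.right _ x (le_of_lt hx)).1, (exp_I_mul_I κ x).1, Complex.norm_real,
      Real.norm_eq_abs, Real.abs_exp, ← Real.exp_nat_mul]
    congr 1
    push_cast; ring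
  constructor
  · exact (integrableOn_congr_fun he measurableSet_Ioi).2
      (integrableOn_exp_mul_Ioi (by linarith) _)
  · rw [setIntegral_congr_fun measurableSet_Ioi he, integral_exp_mul_Ioi (by linarith)]
    simp

lemma continuous_apply (h : IsJostFamily a b n F F') (k : ℂ) : Continuous (F k) :=
  (h.solves k).continuous

lemma integrable_and_integral (h : IsJostFamily a b n F F') (hb : 0 ≤ b n) (hκ : 0 < κ)
    (hD : jostD a b n (Complex.I * κ) = 0) :
    Integrable (fun x => ‖F (Complex.I * κ) x‖ ^ 2) ∧
      ∫ x, ‖F (Complex.I * κ) x‖ ^ 2 =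
        ‖(jostData a b n (Complex.I * κ)).1‖ ^ 2 / (2 * κ) +
          (∫ x in (-b n)..0, ‖F (Complex.I * κ) x‖ ^ 2) + 1 / (2 * κ) := by
  obtain ⟨l1, l2⟩ := h.integrableOn_and_integral_left hκ hD
  obtain ⟨r1, r2⟩ := h.integrableOn_and_integral_right hκ
  have hc : Continuous fun x => ‖F (Complex.I * κ) x‖ ^ 2 :=
    (h.continuous_apply _).norm.pow 2
  have m1 : IntegrableOn (fun x => ‖F (Complex.I * κ) x‖ ^ 2) (Set.Iic 0) := by
    rw [← Set.Iic_union_Ioc_eq_Iic (neg_nonpos.2 hb)]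
    exact l1.union (hc.integrableOn_Ioc)
  have hi : Integrable (fun x => ‖F (Complex.I * κ) x‖ ^ 2) := by
    rw [← integrableOn_univ, ← Set.Iic_union_Ioi (a := (0 : ℝ))]
    exact m1.union r1
  refine ⟨hi, ?_⟩
  rw [← intervalIntegral.integral_Iic_add_Ioi m1 r1, r2,
    ← intervalIntegral.integral_Iic_sub_Iic l1 m1, l2]
  ring

lemma isBoundState (h : IsJostFamily a b n F F') (hb : 0 ≤ b n) (hκ : 0 < κ)
    (hD : jostD a b n (Complex.I * κ) = 0) : IsBoundState (blocks a b n) (-κ ^ 2) := by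
  refine ⟨by nlinarith, F (Complex.I * κ), ?_, fun h0 => ?_, ?_⟩
  · rw [← I_mul_sq]
    simpa using h.isSolution 0 1 (Complex.I * κ)
  · have := (h.right (Complex.I * κ) 0 le_rfl).1
    simp [h0] at this
  · exact (memLp_two_iff_integrable_sq_norm (h.continuous_apply _).aestronglyMeasurable).2
      (h.integrable_and_integral hb hκ hD).1

lemma leftJostOverT_eq (h : IsJostFamily a b n F F') {k : ℂ} (hk : k ≠ 0) :
    leftJostOverT (blocks a b n) k = F k := by
  have hex : ∃ f : ℝ → ℂ, IsSolution (blocks a b n) (k ^ 2) f ∧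
      ∀ᶠ x : ℝ in atTop, f x = Complex.exp (Complex.I * k * x) := by
    refine ⟨F k, by simpa using h.isSolution 0 1 k, ?_⟩
    filter_upwards [eventually_ge_atTop (0 : ℝ)] with x hx using (h.right k x hx).1
  rw [leftJostOverT, dif_pos hex]
  funext x
  rw [h.eq_of_atTop hk hex.choose_spec.1 (α := 0) (β := 1) (by simpa using hex.choose_spec.2) x]
  ring

/-! ### The derivative of `jostD` at a bound state and the norming constant -/

/-- The derivative of `jostD` at a zero on the imaginary axis. -/
lemma jostData_mul_deriv_jostD (h : IsJostFamily a b n F F') (k₀ : ℂ)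
    (hD : jostD a b n k₀ = 0) :
    (jostData a b n k₀).1 * deriv (jostD a b n) k₀ =
      2 * k₀ * (∫ x in (-b n)..0, F k₀ x * F k₀ x) + Complex.I +
        Complex.I * (jostData a b n k₀).1 ^ 2 := by
  set f₀ := (jostData a b n k₀).1 with hf₀
  have hg₀ : (jostData a b n k₀).2 = -(Complex.I * k₀ * f₀) := by
    rw [jostD] at hD; linear_combination hD
  -- The quotient produced by the Wronskian identity on `[-b n, 0]` for the energies `k ^ 2` and `k₀
  -- ^ 2`, whose difference is `(k - k₀) * (k + k₀)`; the terms with `Complex.I` come from the two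
  -- endpoints.
  let g : ℂ → ℂ := fun k => (k + k₀) * (∫ x in (-b n)..0, F k x * F k₀ x) + Complex.I +
    Complex.I * f₀ * (jostData a b n k).1
  have hg : Continuous g := by
    have h1 : Continuous fun k => ∫ x in (-b n)..0, F k x * F k₀ x := by
      refine intervalIntegral.continuous_parametric_intervalIntegral_of_continuous' ?_ _ _
      exact h.continuous.mul ((h.continuous_apply k₀).comp continuous_snd)
    have h2 := (differentiable_jostData a b n).1.continuous
    fun_prop
  have hP : ∀ k, f₀ * jostD a b n k = (k - k₀) * g k := by
    intro k
    have hw := SolvesOff.wronskian_sub (countable_jumps b) (h.solves k) (h.solves k₀) (-b n) 0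
    have e1 := h.left k (-b n) le_rfl
    have e2 := h.left k₀ (-b n) le_rfl
    rw [neg_add_cancel] at e1 e2
    simp only [waveCos_zero, waveSin_zero, one_mul, zero_mul, add_zero, mul_zero,
      zero_add] at e1 e2
    have e3 := h.right k 0 le_rfl
    have e4 := h.right k₀ 0 le_rfl
    simp only [Complex.ofReal_zero, mul_zero, Complex.exp_zero, mul_one] at e3 e4
    rw [e1.1, e1.2, e2.1, e2.2, e3.1, e3.2, e4.1, e4.2, hg₀] at hw
    simp only [g, jostD]
    linear_combination hw
  have hd := hasDerivAt_of_eq_sub_mul hg.continuousAt hP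
  rw [((differentiable_jostD a b n k₀).hasDerivAt.const_mul f₀).unique hd]
  simp only [g]
  ring

/-- The norming constant in terms of the Jost coefficients. -/
lemma leftNormingConstant_pos_and (h : IsJostFamily a b n F F') (hb : 0 ≤ b n) (hκ : 0 < κ)
    (hD : jostD a b n (Complex.I * κ) = 0) :
    0 < leftNormingConstant (blocks a b n) κ ∧
      jostG a b n (-(Complex.I * κ)) =
        Complex.I * (leftNormingConstant (blocks a b n) κ : ℂ) ^ 2 *
          deriv (jostD a b n) (Complex.I * κ) := by
  have hk : Complex.I * (κ : ℂ) ≠ 0 := by simp [hκ.ne']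
  set f₀ := (jostData a b n (Complex.I * κ)).1 with hf₀
  obtain ⟨-, hI⟩ := h.integrable_and_integral hb hκ hD
  rw [← hf₀] at hI
  set J := ∫ x, ‖F (Complex.I * κ) x‖ ^ 2 with hJ
  have hsq : ∀ z : ℂ, (starRingEnd ℂ) z = z → ((‖z‖ ^ 2 : ℝ) : ℂ) = z * z := by
    intro z hz
    push_cast
    rw [← Complex.mul_conj', hz]
  have hJ0 : 0 < J := by
    rw [hI]
    have h1 : 0 ≤ ∫ x in (-b n)..0, ‖F (Complex.I * κ) x‖ ^ 2 :=
      intervalIntegral.integral_nonneg (by linarith) fun x _ => by positivity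
    positivity
  have hc : leftNormingConstant (blocks a b n) κ = (Real.sqrt J)⁻¹ := by
    rw [leftNormingConstant, h.leftJostOverT_eq hk]
  have hc2 : (leftNormingConstant (blocks a b n) κ : ℂ) ^ 2 * J = 1 := by
    rw [hc, ← Complex.ofReal_pow, ← Complex.ofReal_mul, inv_pow, Real.sq_sqrt hJ0.le,
      inv_mul_cancel₀ hJ0.ne', Complex.ofReal_one]
  refine ⟨by rw [hc]; positivity, ?_⟩
  have hfc : f₀ = F (Complex.I * κ) (-b n) := by
    have e1 := (h.left (Complex.I * κ) (-b n) le_rfl).1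
    rw [neg_add_cancel] at e1
    simpa using e1.symm
  have hf2 : ((‖f₀‖ ^ 2 : ℝ) : ℂ) = f₀ * f₀ := hsq _ (by rw [hfc, h.conj_eq hκ])
  have hJc : 2 * (κ : ℂ) * J =
      f₀ * f₀ + 2 * κ * (∫ x in (-b n)..0, F (Complex.I * κ) x * F (Complex.I * κ) x) + 1 := by
    have h1 : (∫ x in (-b n)..0, F (Complex.I * κ) x * F (Complex.I * κ) x) =
        ((∫ x in (-b n)..0, ‖F (Complex.I * κ) x‖ ^ 2 : ℝ) : ℂ) := by
      rw [← intervalIntegral.integral_ofReal]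
      exact intervalIntegral.integral_congr fun x _ => (hsq _ (h.conj_eq hκ x)).symm
    rw [h1, ← hf2, hI]
    push_cast
    have : (κ : ℂ) ≠ 0 := by exact_mod_cast hκ.ne'
    field_simp
  have hder := h.jostData_mul_deriv_jostD (Complex.I * κ) hD
  rw [← hf₀] at hder
  have h2 := jostData_fst a b n (Complex.I * κ)
  rw [hD, zero_add, ← hf₀] at h2
  have h3 := jostD_mul_neg a b n (Complex.I * κ)
  rw [hD, zero_mul, zero_sub, ← h2] at h3
  have hκ' : (κ : ℂ) ≠ 0 := by exact_mod_cast hκ.ne'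
  have hI2 := Complex.I_sq
  -- At the zero, `jostG (iκ) = -2κ f₀`, while the product of `jostG` at `iκ` and `-iκ` is `4κ²`.
  have h4 : f₀ * jostG a b n (-(Complex.I * κ)) = -2 * κ := by
    refine mul_left_cancel₀ (mul_ne_zero two_ne_zero hκ') ?_
    linear_combination h3 + (2 * κ * f₀ * jostG a b n (-(Complex.I * κ)) + 4 * κ ^ 2) * hI2
  have hf0 : f₀ ≠ 0 := by
    intro h0
    rw [h0, zero_mul] at h4
    exact hκ' (by linear_combination (1 / 2 : ℂ) * h4)
  refine mul_left_cancel₀ hf0 ?_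
  -- The boundary terms in the derivative formula are exactly the contributions of the two
  -- exponential tails to `J`, the squared norm.
  have h5 : f₀ * deriv (jostD a b n) (Complex.I * κ) = Complex.I * (2 * κ * J) := by
    rw [hder, hJc]; ring
  linear_combination h4 - Complex.I * (leftNormingConstant (blocks a b n) κ : ℂ) ^ 2 * h5 +
    2 * κ * hc2 - 2 * κ * (leftNormingConstant (blocks a b n) κ : ℂ) ^ 2 * J * hI2

end IsJostFamily

/-! ### Nonvanishing -/

/-- For large `κ` the Jost solution at `iκ` grows to the left, more slowly than `e^{-κx}`. -/
lemma jostData_imag {a b : ℕ → ℝ} {n : ℕ} (hb : Increasing b n) {κ : ℝ} (hκ : 0 < κ)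
    (ha : ∀ j, 1 ≤ j → j ≤ n → a j ≠ 0) (haκ : ∀ j, 1 ≤ j → j ≤ n → |a j| < κ) :
    ∃ f g : ℝ, (jostData a b n (Complex.I * κ)).1 = f ∧
      (jostData a b n (Complex.I * κ)).2 = -(g : ℂ) ∧
      0 < f ∧ 0 < g ∧ 0 ≤ κ * f - g ∧ (1 ≤ n → 0 < κ * f - g) := by
  induction n with
  | zero =>
    refine ⟨1, κ, by simp [jostData], ?_, one_pos, hκ, by simp, by simp⟩
    simp only [jostData]
    linear_combination (κ : ℂ) * Complex.I_sq
  | succ n ih =>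
    obtain ⟨f, g, hf, hg, hf0, hg0, hu, -⟩ := ih (hb.mono n.le_succ)
      (fun j h1 h2 => ha j h1 (h2.trans n.le_succ)) (fun j h1 h2 => haκ j h1 (h2.trans n.le_succ))
    have hh : 0 < b (n + 1) - b n := sub_pos.2 (hb (n + 1) (by omega) le_rfl)
    have ha2 : 0 < a (n + 1) ^ 2 := sq_pos_of_ne_zero (ha (n + 1) (by omega) le_rfl)
    have hlt : a (n + 1) ^ 2 < κ ^ 2 := by
      rw [← sq_abs]
      exact pow_lt_pow_left₀ (haκ (n + 1) (by omega) le_rfl) (abs_nonneg _) two_ne_zero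
    -- Since `κ` exceeds `|a (n + 1)|`, the parameter `k ^ 2 + a ^ 2` equals `-η ^ 2`, and the wave
    -- functions are hyperbolic and positive.
    set η := Real.sqrt (κ ^ 2 - a (n + 1) ^ 2) with hη
    have hη0 : 0 < η := Real.sqrt_pos.2 (by linarith)
    have hη2 : η ^ 2 = κ ^ 2 - a (n + 1) ^ 2 := Real.sq_sqrt (by linarith)
    have hηκ : η ≤ κ := abs_le_of_sq_le_sq' (by linarith) hκ.le |>.2
    set h := b (n + 1) - b n
    have hz : (Complex.I * (κ : ℂ)) ^ 2 + (a (n + 1) : ℂ) ^ 2 = -(η : ℂ) ^ 2 := by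
      rw [I_mul_sq]
      have : (η : ℂ) ^ 2 = (κ : ℂ) ^ 2 - (a (n + 1) : ℂ) ^ 2 := by exact_mod_cast hη2
      rw [this]; push_cast; ring
    obtain ⟨hC, hS⟩ := wave_neg_sq hη0.ne' h
    set C := Real.cosh (η * h)
    set S := Real.sinh (η * h) / η with hSdef
    have hC0 : 0 < C := Real.cosh_pos _
    have hS0 : 0 < S := div_pos (Real.sinh_pos_iff.2 (by positivity)) hη0
    have hCS : 0 ≤ κ * C - η ^ 2 * S := by
      have h1 : η ^ 2 * S = η * Real.sinh (η * h) := by rw [hSdef]; field_simp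
      have h2 : Real.sinh (η * h) < C := Real.sinh_lt_cosh _
      rw [h1]
      nlinarith
    refine ⟨C * f + S * g, η ^ 2 * S * f + C * g, ?_, ?_, by positivity, by positivity, ?_⟩
    · simp only [jostData, hz]
      rw [hC, hS, hf, hg]; push_cast; ring
    · simp only [jostData, hz]
      rw [hC, hS, hf, hg]; push_cast; ring
    · have key : 0 < κ * (κ * (C * f + S * g) - (η ^ 2 * S * f + C * g)) := by
        -- The first product is nonnegative by induction; the strict sign comes from the last term,
        -- where the depth is nonzero.
        have e : κ * (κ * (C * f + S * g) - (η ^ 2 * S * f + C * g)) =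
            (κ * C - η ^ 2 * S) * (κ * f - g) + a (n + 1) ^ 2 * S * g := by
          linear_combination (-S * g) * hη2
        rw [e]
        have := mul_nonneg hCS hu
        positivity
      have := pos_of_mul_pos_right key hκ.le
      exact ⟨this.le, fun _ => this⟩

lemma exists_jost_ne_zero {a b : ℕ → ℝ} {n : ℕ} (hn : 1 ≤ n) (hb : Increasing b n)
    (ha : ∀ j, 1 ≤ j → j ≤ n → a j ≠ 0) : ∃ k, jostD a b n k ≠ 0 ∧ jostG a b n k ≠ 0 := by
  -- Any `κ` above all `|a j|` serves; there `jostD = -(κ f + g)` and `jostG = -(κ f - g)`.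
  set κ : ℝ := 1 + ∑ j ∈ Finset.Icc 1 n, |a j| with hκ
  have hs : ∀ j, 1 ≤ j → j ≤ n → |a j| < κ := by
    intro j h1 h2
    have := Finset.single_le_sum (f := fun j => |a j|) (fun i _ => abs_nonneg _)
      (Finset.mem_Icc.2 ⟨h1, h2⟩)
    linarith
  have hκ0 : 0 < κ := (abs_nonneg _).trans_lt (hs n hn le_rfl)
  obtain ⟨f, g, hf, hg, hf0, hg0, -, hu⟩ := jostData_imag hb hκ0 ha hs
  have hI := Complex.I_sq
  refine ⟨Complex.I * κ, ?_, ?_⟩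
  · have : jostD a b n (Complex.I * κ) = ((-(κ * f + g) : ℝ) : ℂ) := by
      rw [jostD, hf, hg]; push_cast; linear_combination (κ * f : ℂ) * hI
    rw [this, Complex.ofReal_ne_zero]
    have : 0 < κ * f + g := by positivity
    linarith
  · have : jostG a b n (Complex.I * κ) = ((-(κ * f - g) : ℝ) : ℂ) := by
      rw [jostG, hf, hg]; push_cast; linear_combination (κ * f : ℂ) * hI
    rw [this, Complex.ofReal_ne_zero]
    linarith [hu hn]

/-- By the identity theorem an entire function with one nonzero value has discrete zeros, and so
does its reflection. -/
lemma eventually_codiscrete_ne_zero {f : ℂ → ℂ} (hf : Differentiable ℂ f) {z : ℂ} (hz : f z ≠ 0) :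
    ∀ᶠ k in codiscrete ℂ, f k ≠ 0 ∧ f (-k) ≠ 0 := by
  have h1 : ∀ {f : ℂ → ℂ} {z : ℂ}, Differentiable ℂ f → f z ≠ 0 →
      ∀ᶠ k in codiscrete ℂ, f k ≠ 0 := fun hf hz =>
    AnalyticOnNhd.preimage_zero_mem_codiscrete (fun x _ => hf.analyticAt x) hz
  exact (h1 hf hz).and (h1 (f := fun k => f (-k)) (z := -z) (hf.comp differentiable_neg)
    (by simpa using hz))

/-- The function `jostD` of the `n`-th block. -/
def nthD (a b : ℕ → ℝ) (n : ℕ) : ℂ → ℂ := blockD (a n) (b n - b (n - 1))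

/-- The function `jostG` of the `n`-th block. -/
def nthE (a b : ℕ → ℝ) (n : ℕ) : ℂ → ℂ := blockE (a n) (b n - b (n - 1))

lemma nthE_neg (a b : ℕ → ℝ) (n : ℕ) (k : ℂ) : nthE a b n (-k) = nthE a b n k := blockE_neg _ _ _

lemma differentiable_nthD (a b : ℕ → ℝ) (n : ℕ) : Differentiable ℂ (nthD a b n) :=
  differentiable_blockD _ _

lemma differentiable_nthE (a b : ℕ → ℝ) (n : ℕ) : Differentiable ℂ (nthE a b n) :=
  differentiable_blockE _ _

lemma nthD_mul_neg (a b : ℕ → ℝ) (n : ℕ) (k : ℂ) :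
    nthD a b n k * nthD a b n (-k) - nthE a b n k ^ 2 = 4 * k ^ 2 := blockD_mul_neg _ _ _

/-- No zero and no pole of the scattering data of the first `n` blocks is at `±k`. -/
structure Generic (a b : ℕ → ℝ) (N : ℕ) (k : ℂ) : Prop where
  ne_zero : k ≠ 0
  jostD_ne : ∀ n, 1 ≤ n → n ≤ N → jostD a b n k ≠ 0 ∧ jostD a b n (-k) ≠ 0
  jostG_ne : ∀ n, 1 ≤ n → n ≤ N → jostG a b n k ≠ 0 ∧ jostG a b n (-k) ≠ 0
  nthD_ne : ∀ n, 1 ≤ n → n ≤ N → nthD a b n k ≠ 0 ∧ nthD a b n (-k) ≠ 0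
  nthE_ne : ∀ n, 1 ≤ n → n ≤ N → nthE a b n k ≠ 0 ∧ nthE a b n (-k) ≠ 0

lemma eventually_codiscrete_forall {P : ℕ → ℂ → Prop} {N : ℕ}
    (h : ∀ n, 1 ≤ n → n ≤ N → ∀ᶠ k in codiscrete ℂ, P n k) :
    ∀ᶠ k in codiscrete ℂ, ∀ n, 1 ≤ n → n ≤ N → P n k := by
  have := (eventually_all_finset (Finset.Icc 1 N) (l := codiscrete ℂ) (p := P)).2
    fun n hn => h n (Finset.mem_Icc.1 hn).1 (Finset.mem_Icc.1 hn).2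
  filter_upwards [this] with k hk n h1 h2 using hk n (Finset.mem_Icc.2 ⟨h1, h2⟩)

lemma eventually_generic {a b : ℕ → ℝ} {N : ℕ} (hb : Increasing b N)
    (ha : ∀ n, 1 ≤ n → n ≤ N → a n ≠ 0) : ∀ᶠ k in codiscrete ℂ, Generic a b N k := by
  have hw : ∀ n, 1 ≤ n → n ≤ N → ∃ k, nthD a b n k ≠ 0 ∧ nthE a b n k ≠ 0 := by
    intro n h1 h2
    -- Auxiliary data with a single block of the same depth and width as the `n`-th one.
    obtain ⟨k, hk⟩ := exists_jost_ne_zero (a := fun _ => a n)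
      (b := fun j => if j = 0 then b (n - 1) else b n) le_rfl
      (fun j h3 h4 => by
        obtain rfl : j = 1 := by omega
        simpa using hb n h1 h2) (fun _ _ _ => ha n h1 h2)
    rw [jostD_one, jostG_one] at hk
    exact ⟨k, by simpa [nthD, nthE] using hk⟩
  have hj : ∀ n, 1 ≤ n → n ≤ N → ∃ k, jostD a b n k ≠ 0 ∧ jostG a b n k ≠ 0 := fun n h1 h2 =>
    exists_jost_ne_zero h1 (hb.mono h2) fun j h3 h4 => ha j h3 (h4.trans h2)
  filter_upwards [eventually_codiscrete_ne_zero differentiable_id (z := 1) one_ne_zero,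
    eventually_codiscrete_forall (N := N) fun n h1 h2 => eventually_codiscrete_ne_zero
      (differentiable_jostD a b n) (hj n h1 h2).choose_spec.1,
    eventually_codiscrete_forall (N := N) fun n h1 h2 => eventually_codiscrete_ne_zero
      (differentiable_jostG a b n) (hj n h1 h2).choose_spec.2,
    eventually_codiscrete_forall (N := N) fun n h1 h2 => eventually_codiscrete_ne_zero
      (differentiable_nthD a b n) (hw n h1 h2).choose_spec.1,
    eventually_codiscrete_forall (N := N) fun n h1 h2 => eventually_codiscrete_ne_zero
      (differentiable_nthE a b n) (hw n h1 h2).choose_spec.2] with k k1 k2 k3 k4 k5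
  exact ⟨k1.1, k2, k3, k4, k5⟩

lemma Generic.neg {a b : ℕ → ℝ} {N : ℕ} {k : ℂ} (h : Generic a b N k) : Generic a b N (-k) := by
  refine ⟨neg_ne_zero.2 h.ne_zero, ?_, ?_, ?_, ?_⟩ <;> rw [neg_neg] <;> intro n h1 h2
  exacts [(h.jostD_ne n h1 h2).symm, (h.jostG_ne n h1 h2).symm, (h.nthD_ne n h1 h2).symm,
    (h.nthE_ne n h1 h2).symm]

/-! ### The coefficients in terms of the Jost solution -/

/-- The common factor of `p_{n+1}` and `q_{n+1}`. -/
def jostMu (a b : ℕ → ℝ) : ℕ → ℂ → ℂ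
  | 0, k => 1 / (nthD a b 1 k * nthD a b 1 (-k))
  | n + 1, k => 2 * Complex.I * k * nthE a b (n + 1) k * jostMu a b n k /
      (nthD a b (n + 2) k * nthD a b (n + 2) (-k))

section
variable {a b : ℕ → ℝ} {N : ℕ} {k : ℂ}

lemma R0_eq (hb : Increasing b N) (hg : Generic a b N k) {n : ℕ} (h1 : 1 ≤ n) (h2 : n ≤ N) :
    R0 a b n k = nthE a b n k / nthD a b n k :=
  rightReflection_well _ (sub_pos.2 (hb n h1 h2)) hg.ne_zero (hg.nthD_ne n h1 h2).1

lemma tilde_R0_eq (hb : Increasing b N) (hg : Generic a b N k) {n : ℕ} (h1 : 1 ≤ n)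
    (h2 : n ≤ N) : tilde (R0 a b n) k = nthE a b n k / nthD a b n (-k) := by
  rw [tilde, R0_eq hb hg.neg h1 h2, nthE_neg]

lemma R_eq (hb0 : b 0 = 0) (hb : Increasing b N) (hg : Generic a b N k) {n : ℕ} (h1 : 1 ≤ n)
    (h2 : n ≤ N) : R a b n k = jostG a b n (-k) / jostD a b n k :=
  rightReflection_blocks a hb0 (hb.mono h2) hg.ne_zero (hg.jostD_ne n h1 h2).1

lemma tilde_R_eq (hb0 : b 0 = 0) (hb : Increasing b N) (hg : Generic a b N k) {n : ℕ}
    (h1 : 1 ≤ n) (h2 : n ≤ N) : tilde (R a b n) k = jostG a b n k / jostD a b n (-k) := by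
  rw [tilde, R_eq hb0 hb hg.neg h1 h2, neg_neg]

lemma L_eq (hb0 : b 0 = 0) (hb : Increasing b N) (hg : Generic a b N k) {n : ℕ} (h1 : 1 ≤ n)
    (h2 : n ≤ N) : L a b n k =
      jostG a b n k / jostD a b n k * Complex.exp (-(2 * Complex.I * k * b n)) :=
  leftReflection_blocks a hb0 (hb.mono h2) hg.ne_zero (hg.jostD_ne n h1 h2).1

lemma B_eq (hb0 : b 0 = 0) (hb : Increasing b N) (hg : Generic a b N k) {n : ℕ} (h1 : 1 ≤ n)
    (h2 : n ≤ N) : B a b n k = jostG a b n k / jostD a b n k := by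
  rw [B, L_eq hb0 hb hg h1 h2, mul_assoc, ← Complex.exp_add]
  simp

lemma A_eq (hb0 : b 0 = 0) (hb : Increasing b N) (hg : Generic a b N k) {n : ℕ} (h1 : 1 ≤ n)
    (h2 : n ≤ N) : A a b n k = jostG a b n k / jostG a b n (-k) := by
  have e : A a b n k = B a b n k / R a b n k := by rw [A, B]; ring
  obtain ⟨D1, -⟩ := hg.jostD_ne n h1 h2
  rw [e, B_eq hb0 hb hg h1 h2, R_eq hb0 hb hg h1 h2]
  field_simp

lemma R_one_eq_R0 (hb0 : b 0 = 0) : R a b 1 = R0 a b 1 := by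
  rw [R, R0, blocks_one_eq_well hb0]

lemma p_succ (n : ℕ) (k : ℂ) : p a b (n + 2) k =
    M a b (n + 1) k 0 0 * p a b (n + 1) k + M a b (n + 1) k 0 1 * q a b (n + 1) k := by
  simp [p, q, pq, Matrix.mulVec, dotProduct, Fin.sum_univ_two]

lemma q_succ (n : ℕ) (k : ℂ) : q a b (n + 2) k =
    M a b (n + 1) k 1 0 * p a b (n + 1) k + M a b (n + 1) k 1 1 * q a b (n + 1) k := by
  simp [p, q, pq, Matrix.mulVec, dotProduct, Fin.sum_univ_two]

lemma nth_recursion (n : ℕ) (k : ℂ) : 2 * Complex.I * k * jostD a b (n + 1) k =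
      jostD a b n k * nthD a b (n + 1) k - jostG a b n k * nthE a b (n + 1) k ∧
    2 * Complex.I * k * jostG a b (n + 1) k =
      jostD a b n k * nthE a b (n + 1) k - jostG a b n k * nthD a b (n + 1) (-k) :=
  ⟨jostD_succ a b n k, jostG_succ a b n k⟩

/-- Conjugating the transfer matrix of `(jostG, jostD)` by the diagonal factors `-nthD k`, `nthD
(-k)` turns it into a scalar multiple of `M`; `jostMu` accumulates the scalars. -/
lemma p_q_eq (hb0 : b 0 = 0) (hb : Increasing b N) (hg : Generic a b N k) {n : ℕ}
    (hn : n + 1 ≤ N) :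
    p a b (n + 1) k = -nthD a b (n + 1) k * jostG a b (n + 1) k * jostMu a b n k ∧
      q a b (n + 1) k = nthD a b (n + 1) (-k) * jostD a b (n + 1) k * jostMu a b n k := by
  induction n with
  | zero =>
    have hD := hg.nthD_ne 1 le_rfl hn
    have e1 : jostG a b 1 k = nthE a b 1 k := jostG_one a b k
    have e2 : jostD a b 1 k = nthD a b 1 k := jostD_one a b k
    simp only [p, q, pq, R_one_eq_R0 hb0, zero_add, e1, e2, jostMu,
      tilde_R0_eq hb hg le_rfl hn, Matrix.cons_val_zero, Matrix.cons_val_one]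
    obtain ⟨d1, d2⟩ := hD
    constructor <;> field_simp
  | succ n ih =>
    obtain ⟨hp, hq⟩ := ih (by omega)
    obtain ⟨d1, d2⟩ := hg.nthD_ne (n + 1) (by omega) (by omega)
    obtain ⟨d3, d4⟩ := hg.nthD_ne (n + 2) (by omega) hn
    obtain ⟨r1, r2⟩ := nth_recursion (a := a) (b := b) (n + 1) k
    rw [p_succ, q_succ, hp, hq]
    simp only [M, R0_eq hb hg (show 1 ≤ n + 1 by omega) (show n + 1 ≤ N by omega),
      R0_eq hb hg (show 1 ≤ n + 1 + 1 by omega) hn,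
      tilde_R0_eq hb hg (show 1 ≤ n + 1 by omega) (show n + 1 ≤ N by omega),
      tilde_R0_eq hb hg (show 1 ≤ n + 1 + 1 by omega) hn, jostMu, Matrix.cons_val',
      Matrix.cons_val_zero,
      Matrix.cons_val_one, Matrix.of_apply, Matrix.cons_val_fin_one]
    constructor
    · have e : -nthD a b (n + 1 + 1) k * jostG a b (n + 1 + 1) k *
          (2 * Complex.I * k * nthE a b (n + 1) k * jostMu a b n k /
            (nthD a b (n + 2) k * nthD a b (n + 2) (-k))) =
          -nthE a b (n + 1) k * jostMu a b n k / nthD a b (n + 2) (-k) *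
            (2 * Complex.I * k * jostG a b (n + 1 + 1) k) := by
        field_simp
      rw [e, r2]
      field_simp
      ring
    · have e : nthD a b (n + 1 + 1) (-k) * jostD a b (n + 1 + 1) k *
          (2 * Complex.I * k * nthE a b (n + 1) k * jostMu a b n k /
            (nthD a b (n + 2) k * nthD a b (n + 2) (-k))) =
          nthE a b (n + 1) k * jostMu a b n k / nthD a b (n + 2) k *
            (2 * Complex.I * k * jostD a b (n + 1 + 1) k) := by
        field_simp
      rw [e, r1]
      field_simp
      ring

/-- By `nthD_mul_neg`, each `M` has determinant `(2ik nthE)²` over the four `nthD` factors of two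
neighbouring blocks; the product telescopes against the square of `jostMu`. -/
lemma det_prodM_eq (hb : Increasing b N) (hg : Generic a b N k) {n : ℕ} (hn : n + 1 ≤ N) :
    (prodM a b n k).det = jostMu a b n k ^ 2 * (nthD a b 1 k * nthD a b 1 (-k)) *
      (nthD a b (n + 1) k * nthD a b (n + 1) (-k)) := by
  induction n with
  | zero =>
    obtain ⟨d1, d2⟩ := hg.nthD_ne 1 le_rfl hn
    simp only [prodM, Matrix.det_one, jostMu]
    field_simp
  | succ n ih =>
    obtain ⟨d1, d2⟩ := hg.nthD_ne (n + 1) (by omega) (by omega)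
    obtain ⟨d3, d4⟩ := hg.nthD_ne (n + 2) (by omega) hn
    have hw := nthD_mul_neg a b (n + 2) k
    rw [prodM, Matrix.det_mul, ih (by omega), M, Matrix.det_fin_two_of,
      R0_eq hb hg (show 1 ≤ n + 1 by omega) (show n + 1 ≤ N by omega),
      R0_eq hb hg (show 1 ≤ n + 1 + 1 by omega) hn,
      tilde_R0_eq hb hg (show 1 ≤ n + 1 by omega) (show n + 1 ≤ N by omega),
      tilde_R0_eq hb hg (show 1 ≤ n + 1 + 1 by omega) hn, jostMu]
    have hI := Complex.I_sq
    have e : nthE a b (n + 2) k ^ 2 =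
        nthD a b (n + 2) k * nthD a b (n + 2) (-k) + (2 * Complex.I * k) ^ 2 := by
      linear_combination -hw - 4 * k ^ 2 * hI
    field_simp
    rw [e]
    ring

lemma ratio_recursion (hb0 : b 0 = 0) (hb : Increasing b N) (hg : Generic a b N k) {n : ℕ}
    (h1 : 1 ≤ n) (hn : n < N) :
    R a b (n + 1) k =
        -(R a b n k / tilde (R a b n) k) *
          ((A a b n k * R0 a b (n + 1) k - tilde (R a b n) k) /
            (1 - A a b n k * R0 a b (n + 1) k * R a b n k)) ∧
      A a b (n + 1) k =
        R0 a b (n + 1) k / tilde (R0 a b (n + 1)) k * (tilde (R a b n) k / R a b n k) *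
          ((A a b n k * R a b n k - tilde (R0 a b (n + 1)) k) /
            (A a b n k * R0 a b (n + 1) k - tilde (R a b n) k)) := by
  have hn' : n + 1 ≤ N := hn
  obtain ⟨d1, d2⟩ := hg.nthD_ne (n + 1) (by omega) hn'
  have e1 := (hg.nthE_ne (n + 1) (by omega) hn').1
  obtain ⟨D1, D2⟩ := hg.jostD_ne n h1 hn.le
  obtain ⟨G1, G2⟩ := hg.jostG_ne n h1 hn.le
  obtain ⟨D3, -⟩ := hg.jostD_ne (n + 1) (by omega) hn'
  obtain ⟨G3, G4⟩ := hg.jostG_ne (n + 1) (by omega) hn'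
  obtain ⟨r1, r2⟩ := nth_recursion (a := a) (b := b) n k
  obtain ⟨-, r4⟩ := nth_recursion (a := a) (b := b) n (-k)
  rw [nthE_neg, neg_neg] at r4
  have hIk : 2 * Complex.I * k ≠ 0 := by simp [hg.ne_zero]
  rw [R_eq hb0 hb hg (by omega) hn', A_eq hb0 hb hg (by omega) hn', R_eq hb0 hb hg h1 hn.le,
    A_eq hb0 hb hg h1 hn.le, tilde_R_eq hb0 hb hg h1 hn.le, R0_eq hb hg (by omega) hn',
    tilde_R0_eq hb hg (by omega) hn']
  -- Each of the three combinations in the recursion is one Jost coefficient of `n + 1` blocks, up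
  -- to explicit factors: `jostD k`, `jostG (-k)` and `jostG k`.
  have s1 : 1 - jostG a b n k / jostG a b n (-k) * (nthE a b (n + 1) k / nthD a b (n + 1) k) *
      (jostG a b n (-k) / jostD a b n k) =
      2 * Complex.I * k * jostD a b (n + 1) k / (jostD a b n k * nthD a b (n + 1) k) := by
    rw [r1]; field_simp
  have s2 : jostG a b n k / jostG a b n (-k) * (nthE a b (n + 1) k / nthD a b (n + 1) k) -
      jostG a b n k / jostD a b n (-k) =
      2 * Complex.I * -k * jostG a b (n + 1) (-k) * jostG a b n k /
        (jostG a b n (-k) * nthD a b (n + 1) k * jostD a b n (-k)) := by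
    rw [r4]; field_simp
  have s3 : jostG a b n k / jostG a b n (-k) * (jostG a b n (-k) / jostD a b n k) -
      nthE a b (n + 1) k / nthD a b (n + 1) (-k) =
      -(2 * Complex.I * k * jostG a b (n + 1) k) / (jostD a b n k * nthD a b (n + 1) (-k)) := by
    rw [r2]; field_simp; ring
  rw [s1, s2, s3]
  have := hg.ne_zero
  have := Complex.I_ne_zero
  constructor <;> field_simp

lemma B_eq_p_div_q (hb0 : b 0 = 0) (hb : Increasing b N) (hg : Generic a b N k)
    {n : ℕ} (h1 : 1 ≤ n) (hn : n ≤ N) (hμ : jostMu a b (n - 1) k ≠ 0) :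
    B a b n k = -(R0 a b n k / tilde (R0 a b n) k) * (p a b n k / q a b n k) := by
  obtain ⟨m, rfl⟩ : ∃ m, n = m + 1 := ⟨n - 1, by omega⟩
  obtain ⟨d1, d2⟩ := hg.nthD_ne (m + 1) h1 hn
  have e1 := (hg.nthE_ne (m + 1) h1 hn).1
  have D1 := (hg.jostD_ne (m + 1) h1 hn).1
  obtain ⟨hp, hq⟩ := p_q_eq hb0 hb hg hn
  rw [Nat.add_sub_cancel] at hμ
  rw [B_eq hb0 hb hg h1 hn, R0_eq hb hg h1 hn, tilde_R0_eq hb hg h1 hn, hp, hq]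
  field_simp

lemma jostMu_ne_zero (hg : Generic a b N k) {n : ℕ} (hn : n + 1 ≤ N) : jostMu a b n k ≠ 0 := by
  induction n with
  | zero =>
    obtain ⟨d1, d2⟩ := hg.nthD_ne 1 le_rfl hn
    simp [jostMu, d1, d2]
  | succ n ih =>
    obtain ⟨d1, d2⟩ := hg.nthD_ne (n + 2) (by omega) hn
    have := (hg.nthE_ne (n + 1) (by omega) (by omega)).1
    simp [jostMu, d1, d2, this, ih (by omega), hg.ne_zero]

end

/-! ### Meromorphy -/

lemma eventually_nhdsNE_of_codiscrete {P : ℂ → Prop} (h : ∀ᶠ k in codiscrete ℂ, P k) (z : ℂ) :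
    ∀ᶠ k in 𝓝[≠] z, P k := by
  have := mem_codiscrete.1 h z
  rwa [disjoint_principal_right, compl_compl] at this

lemma meromorphic_of_differentiable {f : ℂ → ℂ} (hf : Differentiable ℂ f) : Meromorphic f :=
  fun x => (hf.analyticAt x).meromorphicAt

lemma meromorphic_comp_neg_of_differentiable {f : ℂ → ℂ} (hf : Differentiable ℂ f) :
    Meromorphic fun k => f (-k) :=
  meromorphic_of_differentiable (hf.comp differentiable_neg)

lemma meromorphic_nthD (a b : ℕ → ℝ) (n : ℕ) :
    Meromorphic (nthD a b n) ∧ Meromorphic fun k => nthD a b n (-k) :=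
  ⟨meromorphic_of_differentiable (differentiable_nthD a b n),
    meromorphic_comp_neg_of_differentiable (differentiable_nthD a b n)⟩

lemma meromorphic_jostMu (a b : ℕ → ℝ) (n : ℕ) : Meromorphic (jostMu a b n) := by
  induction n with
  | zero =>
    exact (Meromorphic.const 1).div ((meromorphic_nthD a b 1).1.mul (meromorphic_nthD a b 1).2)
  | succ n ih =>
    refine Meromorphic.div (Meromorphic.mul (meromorphic_of_differentiable ?_) ih)
      ((meromorphic_nthD a b (n + 2)).1.mul (meromorphic_nthD a b (n + 2)).2)
    have := differentiable_nthE a b (n + 1)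
    fun_prop

section
variable {a b : ℕ → ℝ} {N : ℕ}

lemma meromorphic_R0 (hb : Increasing b N) (hg : ∀ᶠ k in codiscrete ℂ, Generic a b N k) {n : ℕ}
    (h1 : 1 ≤ n) (h2 : n ≤ N) : Meromorphic (R0 a b n) ∧ Meromorphic (tilde (R0 a b n)) := by
  have hE := meromorphic_of_differentiable (differentiable_nthE a b n)
  constructor
  · refine (hE.div (meromorphic_nthD a b n).1).congr_codiscrete ?_
    filter_upwards [hg] with k hk using (R0_eq hb hk h1 h2).symm
  · refine (hE.div (meromorphic_nthD a b n).2).congr_codiscrete ?_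
    filter_upwards [hg] with k hk using (tilde_R0_eq hb hk h1 h2).symm

lemma meromorphic_all (hb0 : b 0 = 0) (hb : Increasing b N)
    (hg : ∀ᶠ k in codiscrete ℂ, Generic a b N k) {n : ℕ} (h1 : 1 ≤ n) (h2 : n ≤ N) :
    Meromorphic (R0 a b n) ∧ Meromorphic (R a b n) ∧ Meromorphic (L a b n) ∧
      Meromorphic (A a b n) ∧ Meromorphic (B a b n) ∧
      Meromorphic (p a b n) ∧ Meromorphic (q a b n) := by
  have hD := meromorphic_of_differentiable (differentiable_jostD a b n)
  have hG := meromorphic_of_differentiable (differentiable_jostG a b n)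
  have hG' := meromorphic_comp_neg_of_differentiable (differentiable_jostG a b n)
  refine ⟨(meromorphic_R0 hb hg h1 h2).1, ?_, ?_, ?_, ?_, ?_⟩
  · refine (hG'.div hD).congr_codiscrete ?_
    filter_upwards [hg] with k hk using (R_eq hb0 hb hk h1 h2).symm
  · have hexp : Meromorphic fun k : ℂ => Complex.exp (-(2 * Complex.I * k * b n)) :=
      meromorphic_of_differentiable (by fun_prop)
    refine ((hG.div hD).mul hexp).congr_codiscrete ?_
    filter_upwards [hg] with k hk using (L_eq hb0 hb hk h1 h2).symm
  · refine (hG.div hG').congr_codiscrete ?_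
    filter_upwards [hg] with k hk using (A_eq hb0 hb hk h1 h2).symm
  · refine (hG.div hD).congr_codiscrete ?_
    filter_upwards [hg] with k hk using (B_eq hb0 hb hk h1 h2).symm
  · obtain ⟨m, rfl⟩ : ∃ m, n = m + 1 := ⟨n - 1, by omega⟩
    constructor
    · refine (((meromorphic_nthD a b (m + 1)).1.neg.mul hG).mul
        (meromorphic_jostMu a b m)).congr_codiscrete ?_
      filter_upwards [hg] with k hk using (p_q_eq hb0 hb hk h2).1.symm
    · refine (((meromorphic_nthD a b (m + 1)).2.mul hD).mul
        (meromorphic_jostMu a b m)).congr_codiscrete ?_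
      filter_upwards [hg] with k hk using (p_q_eq hb0 hb hk h2).2.symm

lemma eventually_differentiableAt {f : ℂ → ℂ} (hf : Meromorphic f) :
    ∀ᶠ k in codiscrete ℂ, DifferentiableAt ℂ f k := by
  have := MeromorphicOn.eventually_codiscreteWithin_analyticAt f (meromorphicOn_univ.2 hf)
  filter_upwards [this] with k hk using hk.differentiableAt

lemma eventually_deriv_recursion (hb0 : b 0 = 0) (hb : Increasing b N)
    (hg : ∀ᶠ k in codiscrete ℂ, Generic a b N k) {n : ℕ} (h1 : 1 ≤ n) (h2 : n < N) :
    ∀ᶠ k in codiscrete ℂ,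
      ![deriv (p a b (n + 1)) k, deriv (q a b (n + 1)) k] =
        (M a b n k).mulVec ![deriv (p a b n) k, deriv (q a b n) k] +
          (derivM a b n k).mulVec ![p a b n k, q a b n k] := by
  obtain ⟨m, rfl⟩ : ∃ m, n = m + 1 := ⟨n - 1, by omega⟩
  obtain ⟨-, -, -, -, -, hp, hq⟩ := meromorphic_all hb0 hb hg h1 h2.le
  obtain ⟨r1, r2⟩ := meromorphic_R0 hb hg h1 h2.le
  obtain ⟨r3, r4⟩ := meromorphic_R0 hb hg (Nat.le_add_left 1 (m + 1)) h2
  have h00 : Meromorphic fun z => M a b (m + 1) z 0 0 := r1.neg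
  have h01 : Meromorphic fun z => M a b (m + 1) z 0 1 := (r4.mul r2).neg
  have h10 : Meromorphic fun z => M a b (m + 1) z 1 0 := r3.mul r1
  have h11 : Meromorphic fun z => M a b (m + 1) z 1 1 := r2
  filter_upwards [eventually_differentiableAt hp, eventually_differentiableAt hq,
    eventually_differentiableAt h00, eventually_differentiableAt h01,
    eventually_differentiableAt h10, eventually_differentiableAt h11] with k kp kq k00 k01 k10 k11
  have ep : p a b (m + 1 + 1) = fun k => M a b (m + 1) k 0 0 * p a b (m + 1) k +
      M a b (m + 1) k 0 1 * q a b (m + 1) k := funext (p_succ m)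
  have eq : q a b (m + 1 + 1) = fun k => M a b (m + 1) k 1 0 * p a b (m + 1) k +
      M a b (m + 1) k 1 1 * q a b (m + 1) k := funext (q_succ m)
  have dp := (k00.hasDerivAt.fun_mul kp.hasDerivAt).fun_add (k01.hasDerivAt.fun_mul kq.hasDerivAt)
  have dq := (k10.hasDerivAt.fun_mul kp.hasDerivAt).fun_add (k11.hasDerivAt.fun_mul kq.hasDerivAt)
  rw [ep, eq, dp.deriv, dq.deriv]
  funext i
  simp only [Pi.add_apply, Matrix.mulVec, dotProduct, Fin.sum_univ_two, derivM, Matrix.of_apply,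
    Matrix.cons_val_zero, Matrix.cons_val_one]
  fin_cases i <;> simp only [Fin.zero_eta, Fin.mk_one, Matrix.cons_val_zero,
    Matrix.cons_val_one] <;> ring

/-! ### Simple poles and residues -/

lemma exists_eq_sub_mul_of_simple_zero {D : ℂ → ℂ} {z : ℂ} (hD : AnalyticAt ℂ D z)
    (hz : D z = 0) :
    ∃ D₁ : ℂ → ℂ, AnalyticAt ℂ D₁ z ∧ D₁ z = deriv D z ∧ ∀ k, D k = (k - z) * D₁ k := by
  obtain ⟨s, hs⟩ := hD
  refine ⟨dslope D z, ⟨_, hs.has_fpower_series_dslope_fslope⟩, dslope_same D z, fun k => ?_⟩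
  have := sub_smul_dslope D z k
  rw [hz, sub_zero, smul_eq_mul] at this
  exact this.symm

/-- Dividing the simple zero out of `D` leaves an analytic function over `k - z`, and Cauchy's
formula gives the residue. The equality for `f` is needed only off `z`, since the circles avoid
their centre. -/
lemma isSimplePole_and_hasResidueAt {f g D : ℂ → ℂ} {z : ℂ} (hg : AnalyticAt ℂ g z)
    (hD : AnalyticAt ℂ D z) (hDz : D z = 0) (hD' : deriv D z ≠ 0) (hgz : g z ≠ 0)
    (hf : ∀ᶠ k in 𝓝[≠] z, f k = g k / D k) :
    IsSimplePole f z ∧ HasResidueAt f z (g z / deriv D z) := by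
  obtain ⟨D₁, hD₁, hD₁z, he⟩ := exists_eq_sub_mul_of_simple_zero hD hDz
  have hne : D₁ z ≠ 0 := hD₁z ▸ hD'
  have hh : AnalyticAt ℂ (fun k => g k / D₁ k) z := hg.div hD₁ hne
  have hf' : ∀ᶠ k in 𝓝[≠] z, f k = (k - z)⁻¹ * (g k / D₁ k) := by
    filter_upwards [hf] with k hk
    rw [hk, he, div_mul_eq_div_div_swap, div_eq_mul_inv _ (k - z), mul_comm]
  constructor
  · have hm : MeromorphicAt f z :=
      (hg.meromorphicAt.div hD.meromorphicAt).congr (hf.mono fun k hk => hk.symm)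
    refine (meromorphicOrderAt_eq_int_iff (n := -1) hm).2 ⟨_, hh, div_ne_zero hgz hne, ?_⟩
    filter_upwards [hf'] with k hk
    rw [hk, zpow_neg_one, smul_eq_mul]
  · obtain ⟨ε, hε, hball⟩ := Metric.eventually_nhds_iff_ball.1
      (hh.eventually_analyticAt.and (eventually_nhdsWithin_iff.1 hf'))
    filter_upwards [Ioo_mem_nhdsGT hε] with r hr
    have hsub : Metric.closedBall z r ⊆ Metric.ball z ε := Metric.closedBall_subset_ball hr.2
    have hc : (∮ w in C(z, r), f w) = ∮ w in C(z, r), (w - z)⁻¹ • (g w / D₁ w) := by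
      refine circleIntegral.integral_congr hr.1.le fun w hw => ?_
      refine (hball w (hsub (Metric.sphere_subset_closedBall hw))).2 ?_
      exact Metric.ne_of_mem_sphere hw hr.1.ne'
    rw [hc, DifferentiableOn.circleIntegral_sub_inv_smul (fun w hw =>
      (hball w (hsub hw)).1.differentiableAt.differentiableWithinAt)
      (Metric.mem_ball_self hr.1), smul_eq_mul, hD₁z]

lemma hasValueAt_of_eventually {f g : ℂ → ℂ} {z : ℂ} (hg : ContinuousAt g z)
    (hf : ∀ᶠ k in 𝓝[≠] z, f k = g k) : HasValueAt f z (g z) :=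
  (hg.tendsto.mono_left nhdsWithin_le_nhds).congr' (hf.mono fun _ hk => hk.symm)

lemma jostG_mul_ne_zero {n : ℕ} {k : ℂ} (hk : k ≠ 0) (hD : jostD a b n k = 0) :
    jostG a b n k ≠ 0 ∧ jostG a b n (-k) ≠ 0 := by
  have h := jostD_mul_neg a b n k
  rw [hD, zero_mul, zero_sub] at h
  have : jostG a b n k * jostG a b n (-k) ≠ 0 := by
    intro h0
    rw [h0, neg_zero] at h
    simp [hk] at h
  exact ⟨left_ne_zero_of_mul this, right_ne_zero_of_mul this⟩

/-- The data of the first `N` blocks at a zero of `jostD` on the imaginary axis. -/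
lemma residue_at_zero (hN : 1 ≤ N) (hb0 : b 0 = 0) (hb : Increasing b N)
    (hg : ∀ᶠ k in codiscrete ℂ, Generic a b N k) {κ : ℝ} (hκ : 0 < κ)
    (hD : jostD a b N (Complex.I * κ) = 0) :
    IsSimplePole (B a b N) (Complex.I * κ) ∧ IsSimplePole (R a b N) (Complex.I * κ) ∧
      0 < leftNormingConstant (blocks a b N) κ ∧
      deriv (jostD a b N) (Complex.I * κ) ≠ 0 ∧
      jostG a b N (-(Complex.I * κ)) =
        Complex.I * (leftNormingConstant (blocks a b N) κ : ℂ) ^ 2 *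
          deriv (jostD a b N) (Complex.I * κ) ∧
      HasValueAt (A a b N) (Complex.I * κ)
        (jostG a b N (Complex.I * κ) / jostG a b N (-(Complex.I * κ))) ∧
      HasResidueAt (B a b N) (Complex.I * κ)
        (jostG a b N (Complex.I * κ) / deriv (jostD a b N) (Complex.I * κ)) := by
  obtain ⟨F, F', h⟩ := exists_isJostFamily a hb0 hb
  have hbN : 0 ≤ b N := hb0 ▸ hb.le (Nat.zero_le N) le_rfl
  have hk : Complex.I * (κ : ℂ) ≠ 0 := by simp [hκ.ne']
  obtain ⟨hc, hG⟩ := h.leftNormingConstant_pos_and hbN hκ hD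
  obtain ⟨g1, g2⟩ := jostG_mul_ne_zero hk hD
  have hD' : deriv (jostD a b N) (Complex.I * κ) ≠ 0 := by
    intro h0
    rw [h0, mul_zero] at hG
    exact g2 hG
  have hg' := eventually_nhdsNE_of_codiscrete hg (Complex.I * κ)
  have aD := (differentiable_jostD a b N).analyticAt (Complex.I * κ)
  have aG := (differentiable_jostG a b N).analyticAt (Complex.I * κ)
  have aG' : AnalyticAt ℂ (fun k => jostG a b N (-k)) (Complex.I * κ) :=
    ((differentiable_jostG a b N).comp differentiable_neg).analyticAt _
  obtain ⟨b1, b2⟩ := isSimplePole_and_hasResidueAt aG aD hD hD' g1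
    (hg'.mono fun k hk => B_eq hb0 hb hk hN le_rfl)
  obtain ⟨b3, -⟩ := isSimplePole_and_hasResidueAt aG' aD hD hD' g2
    (hg'.mono fun k hk => R_eq hb0 hb hk hN le_rfl)
  exact ⟨b1, b3, hc, hD', hG, hasValueAt_of_eventually (aG.continuousAt.div aG'.continuousAt g2)
    (hg'.mono fun k hk => A_eq hb0 hb hk hN le_rfl), b2⟩

/-- A zero of `q_N` at which neither the determinant of the recursion vanishes nor `R̃_N^0` has a
pole is a zero of `jostD`, and the remaining factors of `p_N` and `q_N` do not vanish there. -/
lemma factors_at_zero {m : ℕ} (hb0 : b 0 = 0) (hb : Increasing b (m + 1))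
    (hg : ∀ᶠ k in codiscrete ℂ, Generic a b (m + 1) k) {z : ℂ} (hz : z ≠ 0)
    (hD' : jostD a b (m + 1) z = 0 → deriv (jostD a b (m + 1)) z ≠ 0)
    (hq : HasValueAt (q a b (m + 1)) z 0)
    (hdet : ¬ HasValueAt (fun k => (prodM a b m k).det) z 0)
    (hpole : ¬ IsPole (tilde (R0 a b (m + 1))) z) :
    jostD a b (m + 1) z = 0 ∧ nthD a b (m + 1) z ≠ 0 ∧ nthD a b (m + 1) (-z) ≠ 0 ∧
      ∃ μ : ℂ → ℂ, AnalyticAt ℂ μ z ∧ μ z ≠ 0 ∧ ∀ᶠ k in 𝓝[≠] z, jostMu a b m k = μ k := by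
  have hN : 1 ≤ m + 1 := by omega
  have hg' := eventually_nhdsNE_of_codiscrete hg z
  have aD := (differentiable_jostD a b (m + 1)).analyticAt z
  have ad : ∀ n, AnalyticAt ℂ (nthD a b n) z := fun n => (differentiable_nthD a b n).analyticAt z
  have ad' : ∀ n, AnalyticAt ℂ (fun k => nthD a b n (-k)) z := fun n =>
    ((differentiable_nthD a b n).comp differentiable_neg).analyticAt z
  have tend : ∀ {f : ℂ → ℂ}, AnalyticAt ℂ f z → Tendsto f (𝓝[≠] z) (𝓝 (f z)) := fun hf =>
    hf.continuousAt.tendsto.mono_left nhdsWithin_le_nhds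
  -- If this vanished, finiteness of `R̃_N^0 = nthE / nthD (-k)` would make `nthE` vanish too,
  -- contradicting `nthD_mul_neg` at `z ≠ 0`.
  have hd' : nthD a b (m + 1) (-z) ≠ 0 := by
    intro h0
    obtain ⟨w, hw⟩ := tendsto_nhds_of_meromorphicOrderAt_nonneg
      ((meromorphic_R0 hb hg hN le_rfl).2 z) (not_lt.1 hpole)
    have h1 := hw.mul (tend (ad' (m + 1)))
    rw [h0, mul_zero] at h1
    have h2 : Tendsto (nthE a b (m + 1)) (𝓝[≠] z) (𝓝 0) := by
      refine h1.congr' ?_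
      filter_upwards [hg'] with k hk
      rw [tilde_R0_eq hb hk hN le_rfl, div_mul_cancel₀ _ (hk.nthD_ne _ hN le_rfl).2]
    have h3 := tendsto_nhds_unique h2 (tend ((differentiable_nthE a b (m + 1)).analyticAt z))
    have h4 := nthD_mul_neg a b (m + 1) z
    rw [h0, ← h3] at h4
    simp [hz] at h4
  have hμm := meromorphic_jostMu a b m z
  -- The determinant is the square of `jostMu` times entire functions, so it would tend to zero with
  -- `jostMu`.
  have hdet' : Tendsto (jostMu a b m) (𝓝[≠] z) (𝓝 0) → False := by
    intro h0
    refine hdet ?_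
    have h1 := ((h0.pow 2).mul (tend ((ad 1).mul (ad' 1)))).mul
      (tend ((ad (m + 1)).mul (ad' (m + 1))))
    rw [zero_pow two_ne_zero, zero_mul, zero_mul] at h1
    refine h1.congr' ?_
    filter_upwards [hg'] with k hk using (det_prodM_eq hb hk le_rfl).symm
  have hqe : ∀ᶠ k in 𝓝[≠] z, q a b (m + 1) k =
      nthD a b (m + 1) (-k) * jostD a b (m + 1) k * jostMu a b m k :=
    hg'.mono fun k hk => (p_q_eq hb0 hb hk le_rfl).2
  have hDz : jostD a b (m + 1) z = 0 := by
    by_contra hD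
    refine hdet' ?_
    have h1 := hq.div (tend ((ad' (m + 1)).mul aD)) (mul_ne_zero hd' hD)
    rw [zero_div] at h1
    refine h1.congr' ?_
    filter_upwards [hg', hqe] with k hk hk'
    have e1 := (hk.nthD_ne _ hN le_rfl).2
    have e2 := (hk.jostD_ne _ hN le_rfl).1
    simp only [Pi.div_apply, Pi.mul_apply, hk']
    field_simp
  obtain ⟨D₁, hD₁, hD₁z, he⟩ := exists_eq_sub_mul_of_simple_zero aD hDz
  -- The remaining factor of `q` has order exactly 1 and `q` has positive order, so `jostMu` has
  -- order at least 0; `hdet'` excludes positive order.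
  have hord : meromorphicOrderAt (jostMu a b m) z = 0 := by
    have hlin : meromorphicOrderAt (fun k => nthD a b (m + 1) (-k) * jostD a b (m + 1) k) z =
        (1 : ℤ) := by
      refine (meromorphicOrderAt_eq_int_iff (n := 1)
        (f := fun k => nthD a b (m + 1) (-k) * jostD a b (m + 1) k)
        ((ad' (m + 1)).mul aD).meromorphicAt).2
        ⟨fun k => nthD a b (m + 1) (-k) * D₁ k, (ad' (m + 1)).mul hD₁,
        mul_ne_zero hd' (hD₁z ▸ hD' hDz), Eventually.of_forall fun k => ?_⟩
      rw [he, zpow_one, smul_eq_mul]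
      ring
    have h1 := (tendsto_zero_iff_meromorphicOrderAt_pos
      ((meromorphic_all hb0 hb hg hN le_rfl).2.2.2.2.2.2 z)).1 hq
    rw [meromorphicOrderAt_congr hqe] at h1
    have h2 := meromorphicOrderAt_mul (f := fun k => nthD a b (m + 1) (-k) * jostD a b (m + 1) k)
      (g := jostMu a b m) ((ad' (m + 1)).mul aD).meromorphicAt hμm
    have h3 : (0 : WithTop ℤ) < (1 : ℤ) + meromorphicOrderAt (jostMu a b m) z := by
      rw [← hlin, ← h2]; exact h1
    have h4 : ¬ 0 < meromorphicOrderAt (jostMu a b m) z := fun h =>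
      hdet' ((tendsto_zero_iff_meromorphicOrderAt_pos hμm).2 h)
    cases h5 : meromorphicOrderAt (jostMu a b m) z with
    | top => rw [h5] at h4; simp at h4
    | coe o =>
      rw [h5] at h3 h4
      norm_cast at h3 h4 ⊢
      omega
  obtain ⟨μ, hμ, hμz, hμe⟩ := (meromorphicOrderAt_eq_int_iff (n := 0) hμm).1 hord
  have hμe' : ∀ᶠ k in 𝓝[≠] z, jostMu a b m k = μ k :=
    hμe.mono fun k hk => by simpa using hk
  -- Now that `jostMu` is finite at `z`, a zero of `nthD` there would make the determinant vanish.
  refine ⟨hDz, fun h0 => hdet ?_, hd', μ, hμ, hμz, hμe'⟩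
  have h1 := ((((tend hμ).congr' (hμe'.mono fun _ hk => hk.symm)).pow 2).mul
    (tend ((ad 1).mul (ad' 1)))).mul (tend ((ad (m + 1)).mul (ad' (m + 1))))
  simp only [Pi.mul_apply, h0, zero_mul, mul_zero] at h1
  refine h1.congr' ?_
  filter_upwards [hg'] with k hk using (det_prodM_eq hb hk le_rfl).symm

end

end

end BlockScattering

/-! ### The main theorem -/

theorem mainTheorem2 (N : ℕ) (hN : 1 ≤ N) (a b : ℕ → ℝ) (hb0 : b 0 = 0)
    (hb : ∀ n, 1 ≤ n → n ≤ N → b (n - 1) < b n)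
    (ha : ∀ n, 1 ≤ n → n ≤ N → a n ≠ 0) :
    -- all functions involved are meromorphic in the plane
    (∀ n, 1 ≤ n → n ≤ N →
      Meromorphic (R0 a b n) ∧ Meromorphic (R a b n) ∧ Meromorphic (L a b n) ∧
      Meromorphic (A a b n) ∧ Meromorphic (B a b n) ∧
      Meromorphic (p a b n) ∧ Meromorphic (q a b n)) ∧
    -- the representation of `B_n` through the linear recursion
    (∀ n, 1 ≤ n → n ≤ N → ∀ᶠ k in codiscrete ℂ,
      B a b n k = -(R0 a b n k / tilde (R0 a b n) k) * (p a b n k / q a b n k)) ∧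
    -- the recursion for `R_{1,…,n}` and `A_n`
    (∀ᶠ k in codiscrete ℂ, R a b 1 k = R0 a b 1 k ∧ A a b 1 k = 1) ∧
    (∀ n, 1 ≤ n → n < N → ∀ᶠ k in codiscrete ℂ,
      R a b (n + 1) k =
        -(R a b n k / tilde (R a b n) k) *
          ((A a b n k * R0 a b (n + 1) k - tilde (R a b n) k) /
            (1 - A a b n k * R0 a b (n + 1) k * R a b n k)) ∧
      A a b (n + 1) k =
        R0 a b (n + 1) k / tilde (R0 a b (n + 1)) k * (tilde (R a b n) k / R a b n k) *
          ((A a b n k * R a b n k - tilde (R0 a b (n + 1)) k) /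
            (A a b n k * R0 a b (n + 1) k - tilde (R a b n) k))) ∧
    -- the differentiated linear recursion
    (∀ n, 1 ≤ n → n < N → ∀ᶠ k in codiscrete ℂ,
      ![deriv (p a b (n + 1)) k, deriv (q a b (n + 1)) k] =
        (M a b n k).mulVec ![deriv (p a b n) k, deriv (q a b n) k] +
          (derivM a b n k).mulVec ![p a b n k, q a b n k]) ∧
    -- residues of `B_N` at the bound states, and the left norming constants
    (∀ κ : ℝ, 0 < κ → IsBoundState (blocks a b N) (-κ ^ 2) →
      IsSimplePole (B a b N) (Complex.I * κ) ∧
      0 < leftNormingConstant (blocks a b N) κ ∧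
      ∃ α : ℂ, α ≠ 0 ∧ HasValueAt (A a b N) (Complex.I * κ) α ∧
        HasResidueAt (B a b N) (Complex.I * κ)
          (Complex.I * (leftNormingConstant (blocks a b N) κ : ℂ) ^ 2 * α)) ∧
    -- bound states and residues from the zeros of `q_N`
    (∀ κ : ℝ, 0 < κ →
      HasValueAt (q a b N) (Complex.I * κ) 0 →
      ¬ HasValueAt (fun k => (prodM a b (N - 1) k).det) (Complex.I * κ) 0 →
      ¬ IsPole (tilde (R0 a b N)) (Complex.I * κ) →
      IsSimplePole (B a b N) (Complex.I * κ) ∧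
      IsSimplePole (R a b N) (Complex.I * κ) ∧
      IsBoundState (blocks a b N) (-κ ^ 2) ∧
      ∃ r pN qN' α : ℂ, r ≠ 0 ∧ pN ≠ 0 ∧ qN' ≠ 0 ∧ α ≠ 0 ∧
        HasValueAt (fun k => R0 a b N k / tilde (R0 a b N) k) (Complex.I * κ) r ∧
        HasValueAt (p a b N) (Complex.I * κ) pN ∧
        HasValueAt (deriv (q a b N)) (Complex.I * κ) qN' ∧
        HasValueAt (A a b N) (Complex.I * κ) α ∧
        HasResidueAt (B a b N) (Complex.I * κ) (-r * (pN / qN')) ∧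
        HasResidueAt (B a b N) (Complex.I * κ)
          (Complex.I * (leftNormingConstant (blocks a b N) κ : ℂ) ^ 2 * α) ∧
        (leftNormingConstant (blocks a b N) κ : ℂ) ^ 2 = Complex.I * r * pN / (qN' * α)) := by
  have hb' : Increasing b N := hb
  have hg := eventually_generic hb' ha
  refine ⟨fun n h1 h2 => meromorphic_all hb0 hb' hg h1 h2, fun n h1 h2 => ?_, ?_,
    fun n h1 h2 => ?_, fun n h1 h2 => eventually_deriv_recursion hb0 hb' hg h1 h2,
    fun κ hκ hs => ?_, fun κ hκ hq hdet hpole => ?_⟩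
  · filter_upwards [hg] with k hk
    exact B_eq_p_div_q hb0 hb' hk h1 h2 (jostMu_ne_zero hk (by omega))
  · filter_upwards [hg] with k hk
    refine ⟨by rw [R_one_eq_R0 hb0], ?_⟩
    have e : ∀ k, jostG a b 1 k = nthE a b 1 k := jostG_one a b
    rw [A_eq hb0 hb' hk le_rfl hN, e, e, nthE_neg, div_self (hk.nthE_ne 1 le_rfl hN).1]
  · filter_upwards [hg] with k hk using ratio_recursion hb0 hb' hk h1 h2
  · obtain ⟨F, F', h⟩ := exists_isJostFamily a hb0 hb'
    have hD := h.jostD_eq_zero_of_isBoundState hκ hs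
    have hk : Complex.I * (κ : ℂ) ≠ 0 := by simp [hκ.ne']
    obtain ⟨g1, g2⟩ := jostG_mul_ne_zero hk hD
    obtain ⟨b1, -, hc, hD', hG, hA, hres⟩ := residue_at_zero hN hb0 hb' hg hκ hD
    refine ⟨b1, hc, _, div_ne_zero g1 g2, hA, ?_⟩
    convert hres using 1
    rw [mul_div_assoc', div_eq_div_iff g2 hD', hG]
    ring
  · obtain ⟨m, rfl⟩ : ∃ m, N = m + 1 := ⟨N - 1, by omega⟩
    have hk : Complex.I * (κ : ℂ) ≠ 0 := by simp [hκ.ne']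
    rw [Nat.add_sub_cancel] at hdet
    obtain ⟨hD, hd, hd', μ, hμ, hμz, hμe⟩ := factors_at_zero hb0 hb' hg hk
      (fun h0 => (residue_at_zero hN hb0 hb' hg hκ h0).2.2.2.1) hq hdet hpole
    obtain ⟨F, F', h⟩ := exists_isJostFamily a hb0 hb'
    have hbN : 0 ≤ b (m + 1) := hb0 ▸ hb'.le (Nat.zero_le _) le_rfl
    obtain ⟨g1, g2⟩ := jostG_mul_ne_zero hk hD
    obtain ⟨b1, b2, hc, hD', hG, hA, hres⟩ := residue_at_zero hN hb0 hb' hg hκ hD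
    set z := Complex.I * (κ : ℂ)
    have hg' := eventually_nhdsNE_of_codiscrete hg z
    have aD := (differentiable_jostD a b (m + 1)).analyticAt z
    have aG := (differentiable_jostG a b (m + 1)).analyticAt z
    have ad := (differentiable_nthD a b (m + 1)).analyticAt z
    have ad' : AnalyticAt ℂ (fun k => nthD a b (m + 1) (-k)) z :=
      ((differentiable_nthD a b (m + 1)).comp differentiable_neg).analyticAt z
    have hI := Complex.I_ne_zero
    have hc' : (leftNormingConstant (blocks a b (m + 1)) κ : ℂ) ≠ 0 := by exact_mod_cast hc.ne'
    -- The analytic representative of `q` near `z`; only the term with `deriv jostD` survives,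
    -- because `jostD` vanishes at `z`.
    have hqd : HasDerivAt (fun k => nthD a b (m + 1) (-k) * jostD a b (m + 1) k * μ k)
        (nthD a b (m + 1) (-z) * deriv (jostD a b (m + 1)) z * μ z) z := by
      refine ((ad'.differentiableAt.hasDerivAt.fun_mul aD.differentiableAt.hasDerivAt).fun_mul
        hμ.differentiableAt.hasDerivAt).congr_deriv ?_
      rw [hD]; ring
    refine ⟨b1, b2, h.isBoundState hbN hκ hD, nthD a b (m + 1) (-z) / nthD a b (m + 1) z,
      -nthD a b (m + 1) z * jostG a b (m + 1) z * μ z,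
      nthD a b (m + 1) (-z) * deriv (jostD a b (m + 1)) z * μ z,
      jostG a b (m + 1) z / jostG a b (m + 1) (-z), div_ne_zero hd' hd,
      mul_ne_zero (mul_ne_zero (neg_ne_zero.2 hd) g1) hμz,
      mul_ne_zero (mul_ne_zero hd' hD') hμz, div_ne_zero g1 g2, ?_, ?_, ?_, hA, ?_, ?_, ?_⟩
    · refine hasValueAt_of_eventually (ad'.continuousAt.div ad.continuousAt hd) ?_
      filter_upwards [hg'] with k hk'
      have e1 := (hk'.nthE_ne (m + 1) hN le_rfl).1
      obtain ⟨e2, e3⟩ := hk'.nthD_ne (m + 1) hN le_rfl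
      rw [R0_eq hb' hk' hN le_rfl, tilde_R0_eq hb' hk' hN le_rfl]
      simp only [Pi.div_apply]
      field_simp
    · refine hasValueAt_of_eventually
        (g := fun k => -nthD a b (m + 1) k * jostG a b (m + 1) k * μ k)
        ((ad.continuousAt.neg.mul aG.continuousAt).mul hμ.continuousAt) ?_
      filter_upwards [hg', hμe] with k hk' hμk
      rw [(p_q_eq hb0 hb' hk' le_rfl).1, hμk]
    · rw [← hqd.deriv]
      refine hasValueAt_of_eventually ((ad'.mul aD).mul hμ).deriv.continuousAt ?_
      -- Equality on a punctured neighbourhood passes to derivatives there, whatever value `q` takes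
      -- at `z` itself.
      refine EventuallyEq.nhdsNE_deriv ?_
      filter_upwards [hg', hμe] with k hk' hμk
      rw [(p_q_eq hb0 hb' hk' le_rfl).2, hμk]
    · convert hres using 1
      field_simp
    · convert hres using 1
      rw [mul_div_assoc', div_eq_div_iff g2 hD', hG]
      ring
    -- The factors `nthD`, `μ` and `jostG z` cancel, leaving `-i * jostG (-z) / deriv jostD z`,
    -- which is `-i * (i c²) = c²`.
    · rw [hG]
      field_simp
      linear_combination Complex.I_sq
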